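/- Let $P\subset\mathbb{R}^n$ be a $2$-dimensional rational polygon, i.e. the convex hull of finitely many points, all of whose vertices have rational coordinates and whose affine hull has dimension $2$. Then there are (necessarily unique) functions $Q_0(P,\cdot),Q_1(P,\cdot),Q_2(P,\cdot):\mathbb{Q}_{\ge 0}\to\mathbb{Q}$, each periodic with some positive rational period, such that \[\#(rP\cap\mathbb{Z}^n)=Q_2(P,r)\,r^2+Q_1(P,r)\,r+Q_0(P,r)\qquad\text{for all } r\in\mathbb{Q}_{\ge 0};\] the minimum $q(P)=\min\{s\in\mathbb{Q}_{>0}: sP \text{ is a polytope all of whose vertices lie in } \mathbb{Z}^n\}$ exists; and \[|Q_1(P,r)|\le Q_1(P,0)\qquad\text{for all rational } r \text{ with } 0\le r<q(P).\] -/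

import Mathlib

open scoped Pointwise

/-- The integral lattice `ℤⁿ` inside `ℝⁿ`. -/
def integralLattice (n : ℕ) : Set (Fin n → ℝ) := {x | ∀ j, ∃ z : ℤ, x j = z}

/-- The points of `ℝⁿ` all of whose coordinates are rational. -/
def rationalPoints (n : ℕ) : Set (Fin n → ℝ) := {x | ∀ j, ∃ z : ℚ, x j = z}

/-- A polytope is the convex hull of finitely many points. -/
def IsPolytope {n : ℕ} (P : Set (Fin n → ℝ)) : Prop :=
  ∃ s : Set (Fin n → ℝ), s.Finite ∧ P = convexHull ℝ s

/-- A rational polytope: all its vertices (extreme points) have rational coordinates. -/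
def IsRationalPolytope {n : ℕ} (P : Set (Fin n → ℝ)) : Prop :=
  IsPolytope P ∧ P.extremePoints ℝ ⊆ rationalPoints n

/-- An integral polytope: all its vertices (extreme points) have integral coordinates. -/
def IsIntegralPolytope {n : ℕ} (P : Set (Fin n → ℝ)) : Prop :=
  IsPolytope P ∧ P.extremePoints ℝ ⊆ integralLattice n

/-- The dimension of a set: the dimension of its affine hull. -/
noncomputable def setDim {n : ℕ} (P : Set (Fin n → ℝ)) : ℕ :=
  Module.finrank ℝ (affineSpan ℝ P).direction

/-- `Q(P, r) = #(rP ∩ ℤⁿ)` for rational `r ≥ 0`. -/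
noncomputable def latticeCount {n : ℕ} (P : Set (Fin n → ℝ)) (r : ℚ≥0) : ℕ :=
  (((r : ℝ) • P) ∩ integralLattice n).ncard

/-- `c 0, c 1, …, c (dim P)` are coefficient functions of the rational Ehrhart quasi-polynomial
of `P`: each is periodic on `ℚ≥0` with some positive rational period, and
`#(rP ∩ ℤⁿ) = ∑ i ≤ dim P, c i r * r ^ i` for every rational `r ≥ 0`.
The functions with index above `dim P` are set to zero. -/
structure IsRationalEhrhartExpansion {n : ℕ} (P : Set (Fin n → ℝ)) (c : ℕ → ℚ≥0 → ℚ) : Prop where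
  periodic : ∀ i, ∃ d : ℚ≥0, 0 < d ∧ Function.Periodic (c i) d
  eq_zero : ∀ i, setDim P < i → c i = 0
  count_eq : ∀ r : ℚ≥0,
    (latticeCount P r : ℚ) = ∑ i ∈ Finset.range (setDim P + 1), c i r * (r : ℚ) ^ i

/-- A function on `ℚ≥0` with a positive period has a positive integer period. -/
theorem exists_nat_period {f : ℚ≥0 → ℚ} (h : ∃ d : ℚ≥0, 0 < d ∧ Function.Periodic f d) :
    ∃ N : ℕ, 0 < N ∧ Function.Periodic f (N : ℚ≥0) := by
  obtain ⟨d, hd, hf⟩ := h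
  refine ⟨d.num, NNRat.num_pos.2 hd, ?_⟩
  have := hf.nsmul d.den
  rwa [nsmul_eq_mul, NNRat.den_mul_eq_num] at this

/-- The coefficient functions are determined by `P`. -/
theorem IsRationalEhrhartExpansion.unique {n : ℕ} {P : Set (Fin n → ℝ)} {c c' : ℕ → ℚ≥0 → ℚ}
    (h : IsRationalEhrhartExpansion P c) (h' : IsRationalEhrhartExpansion P c') : c = c' := by
  choose N hN hc using fun i => exists_nat_period (h.periodic i)
  choose N' hN' hc' using fun i => exists_nat_period (h'.periodic i)
  set m := setDim P
  set D : ℕ := ∏ i ∈ Finset.range (m + 1), N i * N' i with hD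
  have hDpos : 0 < D := Finset.prod_pos fun i _ => Nat.mul_pos (hN i) (hN' i)
  have key : ∀ (f : ℚ≥0 → ℚ) (M : ℕ), Function.Periodic f (M : ℚ≥0) → M ∣ D →
      ∀ (k : ℕ) (r : ℚ≥0), f (r + (k * D : ℕ)) = f r := by
    rintro f M hf ⟨t, ht⟩ k r
    have := hf.nsmul (k * t) r
    rw [nsmul_eq_mul] at this
    rw [← this, ht]
    congr 2
    push_cast
    ring
  funext i r
  by_cases hi : m < i
  · rw [h.eq_zero i hi, h'.eq_zero i hi]
  have hi' : i ∈ Finset.range (m + 1) := by simp; omega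
  let p : Polynomial ℚ :=
    ∑ j ∈ Finset.range (m + 1), Polynomial.C (c j r - c' j r) * Polynomial.X ^ j
  have hp : p = 0 := by
    apply Polynomial.eq_zero_of_infinite_isRoot
    refine Set.infinite_of_injective_forall_mem
      (f := fun k : ℕ => ((r + (k * D : ℕ) : ℚ≥0) : ℚ)) ?_ ?_
    · intro a b hab
      simp only [NNRat.cast_inj, add_right_inj, Nat.cast_inj] at hab
      exact Nat.eq_of_mul_eq_mul_right hDpos hab
    · intro k
      have e1 := h.count_eq (r + (k * D : ℕ))
      rw [h'.count_eq, ← sub_eq_zero, ← Finset.sum_sub_distrib] at e1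
      simp only [Set.mem_ofPred_eq, Polynomial.IsRoot.def, p, Polynomial.eval_finsetSum,
        Polynomial.eval_mul, Polynomial.eval_C, Polynomial.eval_pow, Polynomial.eval_X]
      rw [← neg_eq_zero, ← Finset.sum_neg_distrib, ← e1]
      refine Finset.sum_congr rfl fun j hj => ?_
      rw [key (c j) (N j) (hc j) ((Dvd.intro _ rfl).trans (Finset.dvd_prod_of_mem _ hj)),
        key (c' j) (N' j) (hc' j) ((Dvd.intro_left _ rfl).trans (Finset.dvd_prod_of_mem _ hj))]
      ring
  have := congrArg (fun q => Polynomial.coeff q i) hp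
  simp only [p, Polynomial.finsetSum_coeff, Polynomial.coeff_C_mul_X_pow,
    Polynomial.coeff_zero] at this
  rw [Finset.sum_ite_eq, if_pos hi'] at this
  linarith

open Classical in
/-- The coefficient function `Q_i(P, ·)` of the rational Ehrhart quasi-polynomial of `P`
(zero if `P` has none). -/
noncomputable def rationalEhrhartCoeff {n : ℕ} (P : Set (Fin n → ℝ)) : ℕ → ℚ≥0 → ℚ :=
  if h : ∃ c, IsRationalEhrhartExpansion P c then h.choose else 0

/-- `q` is the rational denominator of `P`: the least positive rational number such that `qP` is
an integral polytope. -/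
def IsRationalDenominator {n : ℕ} (P : Set (Fin n → ℝ)) (q : ℚ≥0) : Prop :=
  IsLeast {s : ℚ≥0 | 0 < s ∧ IsIntegralPolytope ((s : ℝ) • P)} q

/-! A lattice basis of the direction plane turns the lattice points of `rP` into those of a
translated dilate of a planar lattice polygon, unless the affine hull of `rP` misses the lattice
(`exists_planar_count`). Cut the planar polygon along integral vertical lines and dilate by some `d`
that makes all the corners integral (`latticePolygon.exists_isTrapezoidal`). A column between
heights `z ≤ y` then contains `(⌊y⌋ + 1/2) + (⌊-z⌋ + 1/2)` lattice points, so upper and lower edges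
can be treated separately.

Along one edge, `⌊y⌋ + 1/2` is `y` plus the sawtooth `1/2 - {y}`. For dilation factors `s + k` the
first part sums to a quadratic in `k`. The second is periodic in the column, so it grows by one
period sum `sawSum` whenever `k` grows by one (`exists_sum_floor_segment`).

Adding the edges, the contributions of interior cuts telescope. What remains of the linear
coefficient is a sum of period sums and two terms from the extreme columns. The extreme terms have
absolute value at most half a width, and `abs_sawSum_le` bounds each period sum by its value at
offset `0`; all these bounds are attained at `r = 0` (`IsTrapezoidal.exists_count_eq`). Uniqueness
of the quadratic on each progression makes its coefficients periodic in `r`. -/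

/-! ### Sums of periodic functions over integer intervals -/

theorem sum_range_add_eq_of_periodic {F : ℤ → ℝ} {d : ℕ} (hF : Function.Periodic F (d : ℤ))
    (a : ℤ) : ∑ l ∈ Finset.range d, F (a + l) = ∑ l ∈ Finset.range d, F l := by
  have step : ∀ b : ℤ, ∑ l ∈ Finset.range d, F (b + 1 + l) = ∑ l ∈ Finset.range d, F (b + l) := by
    intro b
    have h1 := Finset.sum_range_succ (fun l : ℕ => F (b + l)) d
    have h2 := Finset.sum_range_succ' (fun l : ℕ => F (b + l)) d
    simp only [hF b, Nat.cast_zero, add_zero] at h1 h2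
    rw [h1] at h2
    rw [add_right_cancel h2]
    refine Finset.sum_congr rfl fun l _ => congrArg F ?_
    push_cast
    ring
  induction a using Int.induction_on with
  | zero => simp
  | succ i ih => rw [step, ih]
  | pred i ih => rw [← ih, ← step, sub_add_cancel]

theorem sum_Ioc_eq_sum_range (F : ℤ → ℝ) (a : ℤ) (n : ℕ) :
    ∑ i ∈ Finset.Ioc a (a + n), F i = ∑ l ∈ Finset.range n, F (a + 1 + l) := by
  induction n with
  | zero => simp
  | succ n ih =>
    have : Finset.Ioc a (a + (n + 1 : ℕ)) = insert (a + 1 + n) (Finset.Ioc a (a + n)) := by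
      ext x; simp only [Finset.mem_Ioc, Finset.mem_insert]; omega
    rw [this, Finset.sum_insert (by simp), ih, Finset.sum_range_succ, add_comm]

theorem sum_Ioc_add_sum_Ioc (F : ℤ → ℝ) {a b c : ℤ} (hab : a ≤ b) (hbc : b ≤ c) :
    ∑ i ∈ Finset.Ioc a b, F i + ∑ i ∈ Finset.Ioc b c, F i = ∑ i ∈ Finset.Ioc a c, F i := by
  rw [← Finset.sum_union]
  · rw [Finset.Ioc_union_Ioc_eq_Ioc hab hbc]
  · rw [Finset.disjoint_left]
    intro x hx hy
    simp only [Finset.mem_Ioc] at hx hy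
    omega

theorem sum_Ioc_of_periodic {F : ℤ → ℝ} {d : ℕ} (hF : Function.Periodic F (d : ℤ))
    {a b : ℤ} (hab : a ≤ b) (k : ℕ) :
    ∑ i ∈ Finset.Ioc a (b + k * d), F i =
      ∑ i ∈ Finset.Ioc a b, F i + k * ∑ l ∈ Finset.range d, F l := by
  induction k with
  | zero => simp
  | succ k ih =>
    rw [← sum_Ioc_add_sum_Ioc F (b := b + k * d) (by nlinarith) (by push_cast; nlinarith),
      ih]
    have : b + ((k + 1 : ℕ) : ℤ) * d = b + k * d + d := by push_cast; ring
    rw [this, sum_Ioc_eq_sum_range, sum_range_add_eq_of_periodic hF]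
    push_cast
    ring

/-! ### Period sums of the sawtooth -/

/-- The sum of the sawtooth function `1/2 - {x}` over one period of an arithmetic progression with
difference `Δ / d`. -/
noncomputable def sawSum (d : ℕ) (Δ : ℤ) (c : ℝ) : ℝ :=
  ∑ l ∈ Finset.range d, (1 / 2 - Int.fract (c + Δ / d * l))

theorem periodic_fract_progression {d : ℕ} (hd : 0 < d) (Δ : ℤ) (c : ℝ) :
    Function.Periodic (fun i : ℤ => 1 / 2 - Int.fract (c + Δ / d * i)) (d : ℤ) := by
  intro i
  have hd' : (d : ℝ) ≠ 0 := by positivity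
  have : c + (Δ : ℝ) / d * ((i + d : ℤ) : ℝ) = c + Δ / d * i + Δ := by
    push_cast
    field_simp
    ring
  simp only [this, Int.fract_add_intCast]

theorem sawSum_add {d : ℕ} (hd : 0 < d) (Δ : ℤ) (c : ℝ) (i : ℤ) :
    sawSum d Δ (c + Δ / d * i) = sawSum d Δ c := by
  have h := sum_range_add_eq_of_periodic (periodic_fract_progression hd Δ c) i
  simp only [sawSum]
  push_cast at h
  rw [← h]
  refine Finset.sum_congr rfl fun l _ => ?_
  congr 2
  ring

/-- The period sum may start at any term, so start at one with least fractional part. Adding a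
further step `y` to this `x` cannot carry past an integer, since that would give a fractional part
below the minimum. Hence `{y} ≤ {x + y}` term by term. -/
theorem sawSum_le {d : ℕ} (hd : 0 < d) (Δ : ℤ) (c : ℝ) : sawSum d Δ c ≤ sawSum d Δ 0 := by
  obtain ⟨i, -, hi⟩ := Finset.exists_min_image (Finset.range d)
    (fun l : ℕ => Int.fract (c + Δ / d * l)) ⟨0, by simpa⟩
  have hmin : ∀ j : ℤ, Int.fract (c + Δ / d * i) ≤ Int.fract (c + Δ / d * j) := by
    intro j
    have hd' : (0 : ℤ) < d := by exact_mod_cast hd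
    have hp := (periodic_fract_progression hd Δ c).sub_zsmul_eq (x := j) (j / d)
    have e : j - (j / d) • (d : ℤ) = ((j % d).toNat : ℤ) := by
      rw [Int.toNat_of_nonneg (Int.emod_nonneg _ hd'.ne'), Int.emod_def, smul_eq_mul, mul_comm]
    rw [e] at hp
    have := hi (j % d).toNat (by
      have := Int.emod_lt_of_pos j hd'
      have := Int.emod_nonneg j hd'.ne'
      simp only [Finset.mem_range]; omega)
    simp only [Int.cast_natCast] at hp
    linarith
  rw [← sawSum_add hd Δ c i]
  refine Finset.sum_le_sum fun l _ => ?_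
  have h1 := hmin (i + l)
  push_cast at h1 ⊢
  rw [mul_add, ← add_assoc] at h1
  set x := c + (Δ : ℝ) / d * i
  set y := (Δ : ℝ) / d * l
  have h3 : Int.fract (0 + y) ≤ Int.fract (x + y) := by
    rw [zero_add]
    by_contra hlt
    push Not at hlt
    obtain ⟨z, hz⟩ := Int.fract_add x y
    have hz' : z = 0 := by
      have b1 := Int.fract_lt_one y
      have b2 := Int.fract_nonneg x
      have b3 := Int.fract_nonneg y
      have b4 := Int.fract_nonneg (x + y)
      have : (-1 : ℝ) < z := by linarith
      have : (-1 : ℤ) < z := by exact_mod_cast this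
      have : (z : ℝ) ≤ 0 := by linarith
      have : z ≤ 0 := by exact_mod_cast this
      omega
    rw [hz', Int.cast_zero] at hz
    linarith [Int.fract_nonneg x]
  linarith

theorem sawSum_neg_zero {d : ℕ} (hd : 0 < d) (Δ : ℤ) : sawSum d (-Δ) 0 = sawSum d Δ 0 := by
  have h := sum_range_add_eq_of_periodic (periodic_fract_progression hd Δ 0) (1 - d)
  simp only [sawSum]
  refine Eq.trans ?_ h
  rw [← Finset.sum_range_reflect]
  refine Finset.sum_congr rfl fun l hl => ?_
  rw [Finset.mem_range] at hl
  congr 3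
  rw [Nat.cast_sub (by omega), Nat.cast_sub (by omega)]
  push_cast
  ring

/-- The lower bound is the upper bound for the reflected progression: the sawtooth is odd off the
integers, while at an integer it takes the value `1/2` on both sides, which only helps. -/
theorem abs_sawSum_le {d : ℕ} (hd : 0 < d) (Δ : ℤ) (c : ℝ) : |sawSum d Δ c| ≤ sawSum d Δ 0 := by
  refine abs_le.2 ⟨?_, sawSum_le hd Δ c⟩
  have h := sawSum_le hd (-Δ) (-c)
  rw [sawSum_neg_zero hd] at h
  have : -sawSum d Δ c ≤ sawSum d (-Δ) (-c) := by
    rw [sawSum, ← Finset.sum_neg_distrib]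
    refine Finset.sum_le_sum fun l _ => ?_
    have e : -c + ((-Δ : ℤ) : ℝ) / d * l = -(c + Δ / d * l) := by push_cast; ring
    rw [e]
    rcases eq_or_ne (Int.fract (c + (Δ : ℝ) / d * l)) 0 with h0 | h0
    · rw [Int.fract_neg_eq_zero.2 h0, h0]; norm_num
    · rw [Int.fract_neg h0]; linarith
  linarith

/-! ### Floor sums along one edge -/

theorem sum_Ioc_linear (m c : ℝ) {a b : ℤ} (hab : a ≤ b) :
    ∑ i ∈ Finset.Ioc a b, (m * i + c) = m * (b * (b + 1) - a * (a + 1)) / 2 + c * (b - a) := by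
  obtain ⟨n, rfl⟩ := Int.le.dest hab
  rw [sum_Ioc_eq_sum_range (fun i : ℤ => m * i + c)]
  clear hab
  induction n with
  | zero => simp
  | succ n ih =>
    rw [Finset.sum_range_succ, ih]
    push_cast
    ring

/-- Summing the integer parts of the heights of an integral segment, dilated by `s + k` and
translated by `(u, v)`, over the integral columns it meets gives a quadratic polynomial in `k`. -/
theorem exists_sum_floor_segment {d : ℕ} (hd : 0 < d) (X Y Y' : ℤ) {s : ℝ} (hs : 0 ≤ s)
    (u v : ℝ) : ∃ C : ℝ, ∀ k : ℕ,
      ∑ i ∈ Finset.Ioc ⌊(s + k) * X + u⌋ ⌊(s + k) * ((X + d : ℤ) : ℝ) + u⌋,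
        ((⌊(s + k) * Y + v + (Y' - Y) / d * (i - (s + k) * X - u)⌋ : ℝ) + 1 / 2) =
      d * (Y + Y') / 2 * (s + k) ^ 2 + (d * v + Y * (Int.fract (s * X + u) - 1 / 2) -
        Y' * (Int.fract (s * ((X + d : ℤ) : ℝ) + u) - 1 / 2) +
        sawSum d (Y' - Y) (s * Y + v - (Y' - Y) / d * (s * X + u))) * (s + k) + C := by
  have hd' : (d : ℝ) ≠ 0 := by positivity
  set c := s * Y + v - (Y' - Y) / d * (s * X + u) with hc
  set a := ⌊s * X + u⌋ with ha
  set b := ⌊s * ((X + d : ℤ) : ℝ) + u⌋ with hb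
  set θ := Int.fract (s * X + u) with hθ
  set θ' := Int.fract (s * ((X + d : ℤ) : ℝ) + u) with hθ'
  have hab : a ≤ b := by
    apply Int.floor_le_floor
    push_cast
    nlinarith [mul_nonneg hs (Nat.cast_nonneg d : (0 : ℝ) ≤ d)]
  have haθ : (a : ℝ) = s * X + u - θ := by rw [hθ, Int.fract]; ring
  have hbθ : (b : ℝ) = s * ((X + d : ℤ) : ℝ) + u - θ' := by rw [hθ', Int.fract]; ring
  set ψ : ℤ → ℝ := fun i => 1 / 2 - Int.fract (c + ((Y' - Y : ℤ) : ℝ) / d * i) with hψ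
  have hper : Function.Periodic ψ (d : ℤ) := periodic_fract_progression hd (Y' - Y) c
  -- The constant collects the sawtooth over the columns present at `k = 0`, the correction turning
  -- `k * sawSum` into `(s + k) * sawSum`, and the endpoint terms of the linear sum.
  refine ⟨∑ i ∈ Finset.Ioc a b, ψ i - s * sawSum d (Y' - Y) c +
    (θ - θ') * (v + (Y' - Y) / d * (1 - θ - θ') / 2), fun k => ?_⟩
  have hfa : ⌊(s + k) * X + u⌋ = a + k * X := by
    rw [ha, ← Int.floor_add_intCast]
    congr 1; push_cast; ring
  have hfb : ⌊(s + k) * ((X + d : ℤ) : ℝ) + u⌋ = b + k * d + k * X := by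
    rw [hb, add_assoc, ← Int.floor_add_intCast]
    congr 1; push_cast; ring
  -- Moving from `s` to `s + k` translates the supporting line by the lattice vector `k (X, Y)`, so
  -- the sawtooth is merely shifted by `k X` columns.
  have hterm : ∀ i : ℤ, (⌊(s + k) * Y + v + (Y' - Y) / d * (i - (s + k) * X - u)⌋ : ℝ) + 1 / 2 =
      (((Y' - Y) / d : ℝ) * i + ((s + k) * Y + v - (Y' - Y) / d * ((s + k) * X + u))) +
      ψ (i - k * X) := by
    intro i
    have e : (s + k) * Y + v + (Y' - Y) / d * (i - (s + k) * X - u) =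
        c + ((Y' - Y : ℤ) : ℝ) / d * ((i - k * X : ℤ) : ℝ) + ((k * Y : ℤ) : ℝ) := by
      rw [hc]; push_cast; ring
    have e2 := Int.self_sub_floor ((s + k) * Y + v + (Y' - Y) / d * (i - (s + k) * X - u))
    have e3 : Int.fract ((s + k) * Y + v + (Y' - Y) / d * (i - (s + k) * X - u)) =
        Int.fract (c + ((Y' - Y : ℤ) : ℝ) / d * ((i - k * X : ℤ) : ℝ)) := by
      rw [e, Int.fract_add_intCast]
    simp only [hψ]
    rw [← e3]
    linarith
  have hle : a + k * X ≤ b + k * d + k * X := by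
    have : (0 : ℤ) ≤ k * d := by positivity
    linarith
  rw [hfa, hfb, Finset.sum_congr rfl fun i _ => hterm i, Finset.sum_add_distrib,
    sum_Ioc_linear _ _ hle]
  have hshift : ∑ i ∈ Finset.Ioc (a + k * X) (b + k * d + k * X), ψ (i - k * X) =
      ∑ i ∈ Finset.Ioc a (b + k * d), ψ i := by
    rw [← Finset.map_add_right_Ioc, Finset.sum_map]
    simp
  have hsaw : ∑ l ∈ Finset.range d, ψ l = sawSum d (Y' - Y) c := by
    simp only [sawSum, hψ]
    push_cast
    rfl
  rw [hshift, sum_Ioc_of_periodic hper hab, hsaw]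
  push_cast at hbθ ⊢
  rw [haθ, hbθ]
  field_simp
  ring

/-! ### Counting lattice points in trapezoidal regions -/

/-- A planar region that is cut by the vertical lines `x = A + j * d`, `j ≤ m`, into trapezoids
whose corners `(A + j * d, Y j)` and `(A + j * d, Z j)` are lattice points. -/
structure IsTrapezoidal (R : Set (ℝ × ℝ)) (d : ℕ) (A : ℤ) (m : ℕ) (Y Z : ℕ → ℤ) : Prop where
  pos : 0 < d
  le : ∀ j ≤ m, Z j ≤ Y j
  first : ∀ y : ℝ, ((A : ℝ), y) ∈ R ↔ Z 0 ≤ y ∧ y ≤ Y 0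
  bounds : ∀ p ∈ R, (A : ℝ) ≤ p.1 ∧ p.1 ≤ ((A + m * d : ℤ) : ℝ)
  strip : ∀ j < m, ∀ x y : ℝ, ((A + j * d : ℤ) : ℝ) ≤ x → x ≤ ((A + j * d + d : ℤ) : ℝ) →
    ((x, y) ∈ R ↔ Z j + (Z (j + 1) - Z j) / d * (x - ((A + j * d : ℤ) : ℝ)) ≤ y ∧
      y ≤ Y j + (Y (j + 1) - Y j) / d * (x - ((A + j * d : ℤ) : ℝ)))

/-- The condition `lo i ≤ hi i + 1` admits empty columns, but only those for which the summand is
exactly `0`. -/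
theorem finite_columns (I : Finset ℤ) (lo hi : ℤ → ℤ) :
    {z : ℤ × ℤ | z.1 ∈ I ∧ lo z.1 ≤ z.2 ∧ z.2 ≤ hi z.1}.Finite ∧
    ((∀ i ∈ I, lo i ≤ hi i + 1) →
      ({z : ℤ × ℤ | z.1 ∈ I ∧ lo z.1 ≤ z.2 ∧ z.2 ≤ hi z.1}.ncard : ℤ) =
        ∑ i ∈ I, (hi i + 1 - lo i)) := by
  have e : {z : ℤ × ℤ | z.1 ∈ I ∧ lo z.1 ≤ z.2 ∧ z.2 ≤ hi z.1} =
      (fun p : (_ : ℤ) × ℤ => (p.1, p.2)) '' (I.sigma fun i => Finset.Icc (lo i) (hi i)) := by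
    ext ⟨i, l⟩
    simp
  have inj : Function.Injective (fun p : (_ : ℤ) × ℤ => (p.1, p.2)) := by
    rintro ⟨a, b⟩ ⟨c, d⟩ h
    simpa using h
  refine ⟨e ▸ (Finset.finite_toSet _).image _, fun h => ?_⟩
  rw [e, Set.ncard_image_of_injective _ inj, Set.ncard_coe_finset, Finset.card_sigma]
  push_cast
  refine Finset.sum_congr rfl fun i hi => ?_
  rw [Int.card_Icc, Int.toNat_of_nonneg]
  linarith [h i hi]

namespace IsTrapezoidal

variable {R : Set (ℝ × ℝ)} {d : ℕ} {A : ℤ} {m : ℕ} {Y Z : ℕ → ℤ}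

theorem nonempty (h : IsTrapezoidal R d A m Y Z) : R.Nonempty :=
  ⟨_, (h.first (Y 0)).2 ⟨by exact_mod_cast h.le 0 (Nat.zero_le _), le_rfl⟩⟩

theorem smul_first (h : IsTrapezoidal R d A m Y Z) {T : ℝ} (hT : 0 ≤ T) (y : ℝ) :
    (T * A, y) ∈ T • R ↔ T * Z 0 ≤ y ∧ y ≤ T * Y 0 := by
  rcases hT.eq_or_lt with rfl | hT
  · rw [Set.zero_smul_set h.nonempty]
    simp only [zero_mul, Set.mem_zero, Prod.mk_eq_zero, true_and]
    exact ⟨fun h => ⟨h.ge, h.le⟩, fun h => le_antisymm h.2 h.1⟩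
  · rw [Set.mem_smul_set_iff_inv_smul_mem₀ hT.ne']
    have : T⁻¹ • (T * (A : ℝ), y) = ((A : ℝ), T⁻¹ * y) := by
      simp [Prod.smul_mk, smul_eq_mul, hT.ne']
    rw [this, h.first, inv_mul_eq_div, le_div_iff₀ hT, div_le_iff₀ hT, mul_comm T, mul_comm T]

theorem smul_bounds (h : IsTrapezoidal R d A m Y Z) {T : ℝ} (hT : 0 ≤ T) {p : ℝ × ℝ}
    (hp : p ∈ T • R) : T * A ≤ p.1 ∧ p.1 ≤ T * ((A + m * d : ℤ) : ℝ) := by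
  obtain ⟨q, hq, rfl⟩ := hp
  have := h.bounds q hq
  exact ⟨mul_le_mul_of_nonneg_left this.1 hT, mul_le_mul_of_nonneg_left this.2 hT⟩

theorem smul_strip (h : IsTrapezoidal R d A m Y Z) {T : ℝ} (hT : 0 ≤ T) {j : ℕ} (hj : j < m)
    {x : ℝ} (y : ℝ) (h1 : T * ((A + j * d : ℤ) : ℝ) ≤ x) (h2 : x ≤ T * ((A + j * d + d : ℤ) : ℝ)) :
    (x, y) ∈ T • R ↔
      T * Z j + (Z (j + 1) - Z j) / d * (x - T * ((A + j * d : ℤ) : ℝ)) ≤ y ∧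
      y ≤ T * Y j + (Y (j + 1) - Y j) / d * (x - T * ((A + j * d : ℤ) : ℝ)) := by
  rcases hT.eq_or_lt with rfl | hT
  · have hx : x = 0 := by linarith
    rw [Set.zero_smul_set h.nonempty]
    simp only [hx, zero_mul, sub_zero, mul_zero, add_zero, Set.mem_zero, Prod.mk_eq_zero, true_and]
    exact ⟨fun h => ⟨h.ge, h.le⟩, fun h => le_antisymm h.2 h.1⟩
  · rw [Set.mem_smul_set_iff_inv_smul_mem₀ hT.ne']
    have e : T⁻¹ • (x, y) = (x / T, y / T) := by
      simp [Prod.smul_mk, smul_eq_mul, div_eq_inv_mul]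
    rw [e, h.strip j hj _ _ (by rw [le_div_iff₀ hT]; linarith) (by rw [div_le_iff₀ hT]; linarith),
      le_div_iff₀ hT, div_le_iff₀ hT]
    have e2 : ∀ a b : ℝ, (a + b * (x / T - ((A + j * d : ℤ) : ℝ))) * T =
        T * a + b * (x - T * ((A + j * d : ℤ) : ℝ)) := by
      intro a b
      field_simp
    rw [e2, e2]

/-- The number of lattice points of a translated dilate, as a sum over columns. -/
theorem ncard_eq (h : IsTrapezoidal R d A m Y Z) {T : ℝ} (hT : 0 ≤ T) (u v : ℝ) :
    (({z : ℤ × ℤ | ((z.1 : ℝ) - u, (z.2 : ℝ) - v) ∈ T • R}.ncard : ℕ) : ℝ) =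
      (if Int.fract (T * A + u) = 0 then (⌊T * Y 0 + v⌋ : ℝ) + 1 + ⌊T * (-Z 0 : ℤ) + -v⌋ else 0) +
      ∑ j ∈ Finset.range m,
        (∑ i ∈ Finset.Ioc ⌊T * ((A + j * d : ℤ) : ℝ) + u⌋ ⌊T * ((A + j * d + d : ℤ) : ℝ) + u⌋,
          ((⌊T * Y j + v + (Y (j + 1) - Y j) / d *
            (i - T * ((A + j * d : ℤ) : ℝ) - u)⌋ : ℝ) + 1 / 2) +
        ∑ i ∈ Finset.Ioc ⌊T * ((A + j * d : ℤ) : ℝ) + u⌋ ⌊T * ((A + j * d + d : ℤ) : ℝ) + u⌋,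
          ((⌊T * (-Z j : ℤ) + -v + ((-Z (j + 1) : ℤ) - (-Z j : ℤ)) / d *
            (i - T * ((A + j * d : ℤ) : ℝ) - u)⌋ : ℝ) + 1 / 2)) := by
  set C : Set (ℤ × ℤ) := {z : ℤ × ℤ | ((z.1 : ℝ) - u, (z.2 : ℝ) - v) ∈ T • R} with hC
  set f : ℕ → ℤ := fun j => ⌊T * ((A + j * d : ℤ) : ℝ) + u⌋ with hf
  have hsucc : ∀ j : ℕ, f (j + 1) = ⌊T * ((A + j * d + d : ℤ) : ℝ) + u⌋ := by
    intro j
    simp only [hf]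
    congr 3
    push_cast; ring
  have hd : (0 : ℝ) < d := by exact_mod_cast h.pos
  -- Sweep from left to right. Half-open column ranges count each cut once; the leftmost cut is the
  -- base case, and contributes only if its abscissa is an integer.
  have key : ∀ j ≤ m, {z ∈ C | z.1 ≤ f j}.Finite ∧ (({z ∈ C | z.1 ≤ f j}.ncard : ℕ) : ℝ) =
      (if Int.fract (T * A + u) = 0 then (⌊T * Y 0 + v⌋ : ℝ) + 1 + ⌊T * (-Z 0 : ℤ) + -v⌋ else 0) +
      ∑ j ∈ Finset.range j,
        (∑ i ∈ Finset.Ioc ⌊T * ((A + j * d : ℤ) : ℝ) + u⌋ ⌊T * ((A + j * d + d : ℤ) : ℝ) + u⌋,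
          ((⌊T * Y j + v + (Y (j + 1) - Y j) / d *
            (i - T * ((A + j * d : ℤ) : ℝ) - u)⌋ : ℝ) + 1 / 2) +
        ∑ i ∈ Finset.Ioc ⌊T * ((A + j * d : ℤ) : ℝ) + u⌋ ⌊T * ((A + j * d + d : ℤ) : ℝ) + u⌋,
          ((⌊T * (-Z j : ℤ) + -v + ((-Z (j + 1) : ℤ) - (-Z j : ℤ)) / d *
            (i - T * ((A + j * d : ℤ) : ℝ) - u)⌋ : ℝ) + 1 / 2)) := by
    intro j
    induction j with
    | zero =>
      intro _
      have hf0 : f 0 = ⌊T * A + u⌋ := by simp [hf]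
      have hz : ∀ z ∈ C, z.1 ≤ f 0 → (z.1 : ℝ) = T * A + u := by
        intro z hz hz1
        have := (h.smul_bounds hT hz).1
        rw [hf0, Int.le_floor] at hz1
        simp only at this
        linarith
      simp only [Finset.range_zero, Finset.sum_empty, add_zero]
      split_ifs with h0
      · have e0 : (f 0 : ℝ) = T * A + u := by
          rw [hf0]
          have := Int.self_sub_floor (T * A + u)
          linarith
        have e : {z ∈ C | z.1 ≤ f 0} = {z : ℤ × ℤ | z.1 ∈ ({f 0} : Finset ℤ) ∧
            -⌊T * (-Z 0 : ℤ) + -v⌋ ≤ z.2 ∧ z.2 ≤ ⌊T * Y 0 + v⌋} := by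
          ext ⟨i, l⟩
          have aux : i = f 0 → ((i, l) ∈ C ↔
              -⌊T * (-Z 0 : ℤ) + -v⌋ ≤ l ∧ l ≤ ⌊T * Y 0 + v⌋) := by
            rintro rfl
            have e1 : (f 0 : ℝ) - u = T * A := by linarith
            rw [hC, Set.mem_ofPred_eq, e1, h.smul_first hT, Int.le_floor, neg_le, Int.le_floor]
            push_cast
            constructor <;> rintro ⟨h1, h2⟩ <;> constructor <;> linarith
          simp only [Set.mem_ofPred_eq, Finset.mem_singleton]
          constructor
          · rintro ⟨h1, h2⟩
            have : i = f 0 := by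
              have := hz _ h1 h2
              rw [← e0] at this
              exact_mod_cast this
            exact ⟨this, (aux this).1 h1⟩
          · rintro ⟨h1, h2⟩
            exact ⟨(aux h1).2 h2, h1.le⟩
        obtain ⟨g1, g2⟩ := finite_columns {f 0} (fun _ => -⌊T * (-Z 0 : ℤ) + -v⌋)
          (fun _ => ⌊T * Y 0 + v⌋)
        rw [e]
        refine ⟨g1, ?_⟩
        have g3 := g2 (fun i _ => by
          have hle : (Z 0 : ℝ) ≤ Y 0 := by exact_mod_cast h.le 0 (Nat.zero_le _)
          have b1 := Int.lt_floor_add_one (T * (-Z 0 : ℤ) + -v)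
          have b2 := Int.lt_floor_add_one (T * Y 0 + v)
          push_cast at b1
          have b3 := mul_le_mul_of_nonneg_left hle hT
          have : (0 : ℝ) < ((⌊T * (-Z 0 : ℤ) + -v⌋ + 1 + ⌊T * Y 0 + v⌋ + 1 : ℤ) : ℝ) := by
            push_cast
            linarith
          have : 0 < ⌊T * (-Z 0 : ℤ) + -v⌋ + 1 + ⌊T * Y 0 + v⌋ + 1 := by exact_mod_cast this
          linarith)
        rw [Finset.sum_singleton] at g3
        rw [← Int.cast_natCast, g3]
        push_cast
        ring
      · have e : {z ∈ C | z.1 ≤ f 0} = ∅ := by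
          rw [Set.eq_empty_iff_forall_notMem]
          rintro z ⟨h1, h2⟩
          apply h0
          rw [← hz z h1 h2, Int.fract_intCast]
        rw [e]
        simp
    | succ j ih =>
      intro hj
      obtain ⟨ih1, ih2⟩ := ih (by omega)
      -- The ceiling of the lower edge is written as `-⌊-·⌋`, so that both edges take the form
      -- handled by `exists_sum_floor_segment`.
      set lo : ℤ → ℤ := fun i => -⌊T * (-Z j : ℤ) + -v + ((-Z (j + 1) : ℤ) - (-Z j : ℤ)) / d *
            (i - T * ((A + j * d : ℤ) : ℝ) - u)⌋ with hlo
      set hi : ℤ → ℤ := fun i => ⌊T * Y j + v + (Y (j + 1) - Y j) / d *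
            (i - T * ((A + j * d : ℤ) : ℝ) - u)⌋ with hhi
      have hle : f j ≤ f (j + 1) := by
        rw [hsucc]
        apply Int.floor_le_floor
        have := mul_nonneg hT hd.le
        push_cast
        linarith
      have hrange : ∀ i ∈ Finset.Ioc (f j) (f (j + 1)),
          T * ((A + j * d : ℤ) : ℝ) ≤ i - u ∧ (i : ℝ) - u ≤ T * ((A + j * d + d : ℤ) : ℝ) := by
        intro i hi
        rw [Finset.mem_Ioc, hsucc, Int.le_floor, Int.floor_lt] at hi
        constructor <;> linarith
      have e : {z ∈ C | z.1 ≤ f (j + 1)} = {z ∈ C | z.1 ≤ f j} ∪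
          {z : ℤ × ℤ | z.1 ∈ Finset.Ioc (f j) (f (j + 1)) ∧ lo z.1 ≤ z.2 ∧ z.2 ≤ hi z.1} := by
        ext ⟨i, l⟩
        have aux : i ∈ Finset.Ioc (f j) (f (j + 1)) → ((i, l) ∈ C ↔ lo i ≤ l ∧ l ≤ hi i) := by
          intro hi'
          obtain ⟨r1, r2⟩ := hrange i hi'
          rw [hC, Set.mem_ofPred_eq, h.smul_strip hT (by omega) _ r1 r2]
          simp only [hlo, hhi]
          rw [Int.le_floor, neg_le, Int.le_floor]
          push_cast
          constructor
          · rintro ⟨a1, a2⟩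
            constructor
            · rw [neg_sub_neg, ← neg_sub ((Z (j + 1) : ℤ) : ℝ), neg_div, neg_mul]; linarith
            · linarith
          · rintro ⟨a1, a2⟩
            rw [neg_sub_neg, ← neg_sub ((Z (j + 1) : ℤ) : ℝ), neg_div, neg_mul] at a1
            constructor <;> linarith
        simp only [Set.mem_ofPred_eq, Set.mem_union]
        constructor
        · rintro ⟨h1, h2⟩
          rcases le_or_gt i (f j) with h3 | h3
          · exact Or.inl ⟨h1, h3⟩
          · have := Finset.mem_Ioc.2 ⟨h3, h2⟩
            exact Or.inr ⟨this, (aux this).1 h1⟩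
        · rintro (⟨h1, h2⟩ | ⟨h1, h2⟩)
          · exact ⟨h1, h2.trans hle⟩
          · exact ⟨(aux h1).2 h2, (Finset.mem_Ioc.1 h1).2⟩
      obtain ⟨g1, g2⟩ := finite_columns (Finset.Ioc (f j) (f (j + 1))) lo hi
      have g3 := g2 (fun i hi' => by
        obtain ⟨r1, r2⟩ := hrange i hi'
        have w1 : (Z j : ℝ) ≤ Y j := by exact_mod_cast h.le j (by omega)
        have w2 : (Z (j + 1) : ℝ) ≤ Y (j + 1) := by exact_mod_cast h.le (j + 1) (by omega)
        have b1 := Int.lt_floor_add_one (T * (-Z j : ℤ) + -v +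
          ((-Z (j + 1) : ℤ) - (-Z j : ℤ)) / d * (i - T * ((A + j * d : ℤ) : ℝ) - u))
        have b2 := Int.lt_floor_add_one (T * Y j + v + (Y (j + 1) - Y j) / d *
            (i - T * ((A + j * d : ℤ) : ℝ) - u))
        -- With `0 ≤ t ≤ T`, the height of the column is `(T - t)(Y j - Z j) + t (Y (j + 1) - Z (j +
        -- 1)) ≥ 0`. The two floors therefore sum to more than `-2`, hence to at least `-1`.
        set t : ℝ := (i - T * ((A + j * d : ℤ) : ℝ) - u) / d with ht
        have t0 : 0 ≤ t := div_nonneg (by linarith) hd.le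
        have t1 : t ≤ T := by
          rw [ht, div_le_iff₀ hd]
          push_cast at r2 ⊢
          linarith
        have e1 : ∀ a : ℝ, a / d * (i - T * ((A + j * d : ℤ) : ℝ) - u) = a * t := by
          intro a; rw [ht]; ring
        simp only [hlo, hhi]
        rw [e1] at b1 b2 ⊢
        rw [e1]
        have b3 := mul_nonneg (sub_nonneg.2 t1) (sub_nonneg.2 w1)
        have b4 := mul_nonneg t0 (sub_nonneg.2 w2)
        have : (0 : ℝ) < ((⌊T * (-Z j : ℤ) + -v + ((-Z (j + 1) : ℤ) - (-Z j : ℤ)) * t⌋ + 1 +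
            ⌊T * Y j + v + (Y (j + 1) - Y j) * t⌋ + 1 : ℤ) : ℝ) := by
          push_cast at b1 b2 ⊢
          linarith
        have : 0 < ⌊T * (-Z j : ℤ) + -v + ((-Z (j + 1) : ℤ) - (-Z j : ℤ)) * t⌋ + 1 +
            ⌊T * Y j + v + (Y (j + 1) - Y j) * t⌋ + 1 := by exact_mod_cast this
        linarith)
      rw [e]
      refine ⟨ih1.union g1, ?_⟩
      rw [Set.ncard_union_eq _ ih1 g1, Nat.cast_add, ih2, Finset.sum_range_succ, add_assoc,
        add_right_inj, add_right_inj, ← Finset.sum_add_distrib, ← hsucc, ← Int.cast_natCast, g3]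
      · rw [Int.cast_sum]
        refine Finset.sum_congr rfl fun i _ => ?_
        simp only [hlo, hhi]
        push_cast
        ring
      · rw [Set.disjoint_left]
        rintro z ⟨-, h1⟩ ⟨h2, -⟩
        rw [Finset.mem_Ioc] at h2
        omega
  have hall : {z ∈ C | z.1 ≤ f m} = C := by
    ext z
    refine ⟨fun h => h.1, fun hz => ⟨hz, ?_⟩⟩
    have := (h.smul_bounds hT hz).2
    simp only at this
    simp only [hf]
    rw [Int.le_floor]
    linarith
  rw [← hall]
  exact (key m le_rfl).2

/-- The lattice point count of the translated dilates of a trapezoidal region is a quadratic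
polynomial along arithmetic progressions of dilation factors with difference `1`, and its linear
coefficient is largest in absolute value for the integral dilates. -/
theorem exists_count_eq (h : IsTrapezoidal R d A m Y Z) : ∃ a b₀ : ℝ, ∀ s u v : ℝ, 0 ≤ s →
    ∃ b c : ℝ, |b| ≤ b₀ ∧ (s = 0 → u = 0 → v = 0 → b = b₀) ∧ ∀ k : ℕ,
      (({z : ℤ × ℤ | ((z.1 : ℝ) - u, (z.2 : ℝ) - v) ∈ (s + k) • R}.ncard : ℕ) : ℝ) =
        a * (s + k) ^ 2 + b * (s + k) + c := by
  set W : ℕ → ℝ := fun j => Y j - Z j with hW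
  refine ⟨∑ j ∈ Finset.range m, d * (W j + W (j + 1)) / 2,
    (W 0 + W m) / 2 + ∑ j ∈ Finset.range m,
      (sawSum d (Y (j + 1) - Y j) 0 + sawSum d (-Z (j + 1) - -Z j) 0), fun s u v hs => ?_⟩
  choose C₁ hC₁ using fun j : ℕ =>
    exists_sum_floor_segment h.pos (A + j * d) (Y j) (Y (j + 1)) hs u v
  choose C₂ hC₂ using fun j : ℕ =>
    exists_sum_floor_segment h.pos (A + j * d) (-Z j) (-Z (j + 1)) hs u (-v)
  set θ : ℕ → ℝ := fun j => Int.fract (s * ((A + j * d : ℤ) : ℝ) + u) with hθ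
  set c₁ : ℕ → ℝ := fun j => s * Y j + v - (Y (j + 1) - Y j) / d * (s * ((A + j * d : ℤ) : ℝ) + u)
    with hc₁
  set c₂ : ℕ → ℝ := fun j => s * (-Z j : ℤ) + -v -
    ((-Z (j + 1) : ℤ) - (-Z j : ℤ)) / d * (s * ((A + j * d : ℤ) : ℝ) + u) with hc₂
  have hθs : ∀ j : ℕ, Int.fract (s * ((A + j * d + d : ℤ) : ℝ) + u) = θ (j + 1) := by
    intro j
    simp only [hθ]
    congr 3
    push_cast; ring
  have hW0 : 0 ≤ W 0 := sub_nonneg.2 (by exact_mod_cast h.le 0 (Nat.zero_le _))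
  have hWm : 0 ≤ W m := sub_nonneg.2 (by exact_mod_cast h.le m le_rfl)
  -- Records whether the leftmost cut is an integral column. The factor `θ 0 - 1/2 + δ` then stays
  -- in `[-1/2, 1/2]` and equals `1/2` when `θ 0 = 0`.
  set δ : ℝ := if θ 0 = 0 then 1 else 0 with hδ
  refine ⟨W 0 * (θ 0 - 1 / 2 + δ) + W m * (1 / 2 - θ m) + ∑ j ∈ Finset.range m,
      (sawSum d (Y (j + 1) - Y j) (c₁ j) + sawSum d (-Z (j + 1) - -Z j) (c₂ j)),
    δ * (⌊s * Y 0 + v⌋ + 1 + ⌊s * (-Z 0 : ℤ) + -v⌋ - s * W 0) +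
      ∑ j ∈ Finset.range m, (C₁ j + C₂ j), ?_, ?_, fun k => ?_⟩
  · have b0 : |W 0 * (θ 0 - 1 / 2 + δ)| ≤ W 0 / 2 := by
      rw [abs_mul, abs_of_nonneg hW0, div_eq_mul_one_div]
      refine mul_le_mul_of_nonneg_left ?_ hW0
      have t1 : 0 ≤ θ 0 := Int.fract_nonneg _
      have t2 : θ 0 < 1 := Int.fract_lt_one _
      rw [hδ]
      split_ifs with h0
      · rw [h0]; norm_num
      · rw [abs_le]; constructor <;> linarith
    have bm : |W m * (1 / 2 - θ m)| ≤ W m / 2 := by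
      rw [abs_mul, abs_of_nonneg hWm, div_eq_mul_one_div]
      refine mul_le_mul_of_nonneg_left ?_ hWm
      have t1 : 0 ≤ θ m := Int.fract_nonneg _
      have t2 : θ m < 1 := Int.fract_lt_one _
      rw [abs_le]; constructor <;> linarith
    have bs : |∑ j ∈ Finset.range m,
        (sawSum d (Y (j + 1) - Y j) (c₁ j) + sawSum d (-Z (j + 1) - -Z j) (c₂ j))| ≤
        ∑ j ∈ Finset.range m,
          (sawSum d (Y (j + 1) - Y j) 0 + sawSum d (-Z (j + 1) - -Z j) 0) :=
      (Finset.abs_sum_le_sum_abs _ _).trans (Finset.sum_le_sum fun j _ =>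
        (abs_add_le _ _).trans (add_le_add (abs_sawSum_le h.pos _ _) (abs_sawSum_le h.pos _ _)))
    refine (abs_add_le _ _).trans (add_le_add ((abs_add_le _ _).trans ?_) bs)
    linarith
  · rintro rfl rfl rfl
    have t : ∀ j, θ j = 0 := by intro j; simp [hθ]
    have t1 : ∀ j, c₁ j = 0 := by intro j; simp [hc₁]
    have t2 : ∀ j, c₂ j = 0 := by intro j; simp [hc₂]
    simp only [t, t1, t2, hδ, if_true]
    ring
  · have hT : 0 ≤ s + k := by positivity
    -- Interior cuts cancel between neighbouring strips, leaving the widths `W 0` and `W m`.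
    have tele := Finset.sum_range_sub (fun j => W j * (1 / 2 - θ j)) m
    have hfr : Int.fract ((s + k) * A + u) = θ 0 := by
      simp only [hθ]
      rw [← Int.fract_add_intCast (s * ((A + (0 : ℕ) * d : ℤ) : ℝ) + u) (k * A)]
      congr 1
      push_cast; ring
    have hf1 : (⌊(s + k) * Y 0 + v⌋ : ℝ) = ⌊s * Y 0 + v⌋ + k * Y 0 := by
      have : (s + k) * Y 0 + v = s * Y 0 + v + ((k * Y 0 : ℤ) : ℝ) := by push_cast; ring
      rw [this, Int.floor_add_intCast]
      push_cast; ring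
    have hf2 : (⌊(s + k) * (-Z 0 : ℤ) + -v⌋ : ℝ) = ⌊s * (-Z 0 : ℤ) + -v⌋ - k * Z 0 := by
      have : (s + k) * (-Z 0 : ℤ) + -v = s * (-Z 0 : ℤ) + -v + ((-(k * Z 0) : ℤ) : ℝ) := by
        push_cast; ring
      rw [this, Int.floor_add_intCast]
      push_cast; ring
    have hcol : (if Int.fract ((s + k) * A + u) = 0 then
        (⌊(s + k) * Y 0 + v⌋ : ℝ) + 1 + ⌊(s + k) * (-Z 0 : ℤ) + -v⌋ else 0) =
        δ * W 0 * (s + k) + δ * (⌊s * Y 0 + v⌋ + 1 + ⌊s * (-Z 0 : ℤ) + -v⌋ - s * W 0) := by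
      rw [hfr, hf1, hf2, hδ]
      split_ifs
      · simp only [hW]; ring
      · ring
    rw [h.ncard_eq hT, hcol]
    have hsum : ∀ j ∈ Finset.range m, _ = (d * (W j + W (j + 1)) / 2) * (s + k) ^ 2 +
        ((sawSum d (Y (j + 1) - Y j) (c₁ j) + sawSum d (-Z (j + 1) - -Z j) (c₂ j)) * (s + k) +
        (W (j + 1) * (1 / 2 - θ (j + 1)) - W j * (1 / 2 - θ j)) * (s + k)) + (C₁ j + C₂ j) :=
      fun j _ => (congrArg₂ (· + ·) (hC₁ j k) (hC₂ j k)).trans (by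
        rw [hθs j]
        change d * (Y j + Y (j + 1)) / 2 * (s + k) ^ 2 + (d * v +
          Y j * (θ j - 1 / 2) - Y (j + 1) * (θ (j + 1) - 1 / 2) +
          sawSum d (Y (j + 1) - Y j) (c₁ j)) * (s + k) + C₁ j +
          (d * ((-Z j : ℤ) + (-Z (j + 1) : ℤ)) / 2 * (s + k) ^ 2 + (d * -v +
          (-Z j : ℤ) * (θ j - 1 / 2) - (-Z (j + 1) : ℤ) * (θ (j + 1) - 1 / 2) +
          sawSum d (-Z (j + 1) - -Z j) (c₂ j)) * (s + k) + C₂ j) = _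
        simp only [hW]
        push_cast
        ring)
    rw [Finset.sum_congr rfl hsum, Finset.sum_add_distrib, Finset.sum_add_distrib,
      Finset.sum_add_distrib, ← Finset.sum_mul, ← Finset.sum_mul, ← Finset.sum_mul, tele]
    ring

end IsTrapezoidal

/-! ### Trapezoidal decomposition of a lattice polygon -/

/-- The convex hull in the plane of a finite set of lattice points. -/
def latticePolygon (S : Finset (ℤ × ℤ)) : Set (ℝ × ℝ) :=
  convexHull ℝ ((fun p : ℤ × ℤ => ((p.1 : ℝ), (p.2 : ℝ))) '' S)

namespace latticePolygon

variable {S : Finset (ℤ × ℤ)}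

theorem convex : Convex ℝ (latticePolygon S) := convex_convexHull ℝ _

theorem mem_of_mem {p : ℤ × ℤ} (hp : p ∈ S) : ((p.1 : ℝ), (p.2 : ℝ)) ∈ latticePolygon S :=
  subset_convexHull ℝ _ ⟨p, hp, rfl⟩

theorem le_of_forall_le {α β γ : ℝ} (h : ∀ p ∈ S, α * (p.1 : ℝ) + β * (p.2 : ℝ) ≤ γ)
    {z : ℝ × ℝ} (hz : z ∈ latticePolygon S) : α * z.1 + β * z.2 ≤ γ := by
  have hc : Convex ℝ {z : ℝ × ℝ | α * z.1 + β * z.2 ≤ γ} := by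
    apply convex_halfSpace_le (f := fun z : ℝ × ℝ => α * z.1 + β * z.2)
    constructor
    · intro x y; simp only [Prod.fst_add, Prod.snd_add]; ring
    · intro c x; simp only [Prod.smul_fst, Prod.smul_snd, smul_eq_mul]; ring
  refine convexHull_min ?_ hc hz
  rintro _ ⟨p, hp, rfl⟩
  exact h p hp

theorem mem_interp {x x' y y' t : ℝ} (h : (x, y) ∈ latticePolygon S)
    (h' : (x', y') ∈ latticePolygon S) (ht : 0 ≤ t) (ht' : t ≤ 1) :
    (x + t * (x' - x), y + t * (y' - y)) ∈ latticePolygon S := by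
  have := convex h h' (sub_nonneg.2 ht') ht (by ring)
  convert this using 1
  simp only [Prod.smul_mk, Prod.mk_add_mk, smul_eq_mul, Prod.mk.injEq]
  constructor <;> ring

/-- The top of a column is the highest crossing of a chord joining a point of `S` on its left to one
on its right, hence rational. A supporting line through that crossing shows that nothing lies above
it. -/
theorem exists_rat_top (i : ℤ) (hl : ∃ p ∈ S, p.1 ≤ i) (hr : ∃ q ∈ S, i ≤ q.1) :
    ∃ M : ℚ, ((i : ℝ), (M : ℝ)) ∈ latticePolygon S ∧
      ∀ y : ℝ, ((i : ℝ), y) ∈ latticePolygon S → y ≤ M := by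
  classical
  -- If both abscissas equal `i`, division by zero yields `0`, and the value is the height of the
  -- first point.
  set g : (ℤ × ℤ) × (ℤ × ℤ) → ℚ := fun t =>
    t.1.2 + (i - t.1.1) / (t.2.1 - t.1.1) * (t.2.2 - t.1.2) with hg
  obtain ⟨p₁, hp₁, hp₁i⟩ := hl
  obtain ⟨q₁, hq₁, hq₁i⟩ := hr
  obtain ⟨⟨p₀, q₀⟩, h₀, hmax⟩ := Finset.exists_max_image
    ((S ×ˢ S).filter fun t => t.1.1 ≤ i ∧ i ≤ t.2.1) g
    ⟨(p₁, q₁), by simp [hp₁, hq₁, hp₁i, hq₁i]⟩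
  simp only [Finset.mem_filter, Finset.mem_product] at h₀ hmax
  obtain ⟨⟨hp₀, hq₀⟩, hp₀i, hq₀i⟩ := h₀
  set M := g (p₀, q₀) with hM
  have hmax' : ∀ p ∈ S, ∀ q ∈ S, p.1 ≤ i → i ≤ q.1 →
      (p.2 : ℝ) + (i - p.1) / (q.1 - p.1) * (q.2 - p.2) ≤ M := by
    intro p hp q hq h1 h2
    have := hmax (p, q) ⟨⟨hp, hq⟩, h1, h2⟩
    have : ((g (p, q) : ℚ) : ℝ) ≤ M := by exact_mod_cast this
    simpa [hg] using this
  refine ⟨M, ?_, ?_⟩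
  · have h1 : (p₀.1 : ℝ) ≤ i := by exact_mod_cast hp₀i
    have h2 : (i : ℝ) ≤ q₀.1 := by exact_mod_cast hq₀i
    have := mem_interp (mem_of_mem hp₀) (mem_of_mem hq₀)
      (t := ((i : ℝ) - p₀.1) / (q₀.1 - p₀.1)) (div_nonneg (by linarith) (by linarith))
      (div_le_one_of_le₀ (by linarith) (by linarith))
    convert this using 2
    · rcases eq_or_ne ((q₀.1 : ℝ) - p₀.1) 0 with h0 | h0
      · rw [h0]; linarith
      · rw [div_mul_cancel₀ _ h0]; ring
    · simp [hM, hg]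
  -- The slope is the largest one from `(i, M)` to a point on the right; points on the left lie
  -- below this line because `M` is maximal among chord heights.
  · have hσ : ∃ σ : ℝ, ∀ p ∈ S, (p.2 : ℝ) ≤ M + σ * (p.1 - i) := by
      by_cases hright : (S.filter fun q => i < q.1).Nonempty
      · obtain ⟨q, hq, hqmax⟩ := Finset.exists_max_image _
          (fun q : ℤ × ℤ => ((q.2 : ℝ) - M) / (q.1 - i)) hright
        simp only [Finset.mem_filter] at hq hqmax
        refine ⟨((q.2 : ℝ) - M) / (q.1 - i), fun p hp => ?_⟩
        have hqi : (0 : ℝ) < q.1 - i := sub_pos.2 (by exact_mod_cast hq.2)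
        rcases lt_or_ge i p.1 with h | h
        · have hpi : (0 : ℝ) < p.1 - i := sub_pos.2 (by exact_mod_cast h)
          have := hqmax p ⟨hp, h⟩
          rw [div_le_iff₀ hpi] at this
          linarith
        · have h1 := hmax' p hp q hq.1 h hq.2.le
          have hpi : (0 : ℝ) ≤ i - p.1 := sub_nonneg.2 (by exact_mod_cast h)
          have hpq : (0 : ℝ) < q.1 - p.1 := by linarith
          rw [div_mul_eq_mul_div, ← le_sub_iff_add_le', div_le_iff₀ hpq] at h1
          rw [div_mul_eq_mul_div, ← sub_le_iff_le_add', le_div_iff₀ hqi]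
          linarith
      · have hno : ∀ p ∈ S, p.1 ≤ i := by
          intro p hp
          by_contra h
          exact hright ⟨p, Finset.mem_filter.2 ⟨hp, not_le.1 h⟩⟩
        -- With no point on the right, a steep descending line suffices: other abscissas are at
        -- distance at least `1`.
        refine ⟨-∑ p ∈ S, |(p.2 : ℝ) - M|, fun p hp => ?_⟩
        rcases (hno p hp).eq_or_lt with h | h
        · have := hmax' p hp p hp h.le h.ge
          simp only [sub_self, mul_zero, add_zero] at this
          rw [h]; linarith
        · have h1 : (1 : ℝ) ≤ i - p.1 := by
            have : p.1 + 1 ≤ i := h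
            have : ((p.1 : ℝ) + 1) ≤ i := by exact_mod_cast this
            linarith
          have h2 := Finset.single_le_sum (f := fun p : ℤ × ℤ => |(p.2 : ℝ) - M|)
            (fun p _ => abs_nonneg _) hp
          have h3 := le_abs_self ((p.2 : ℝ) - M)
          have h4 : 0 ≤ ∑ p ∈ S, |(p.2 : ℝ) - M| := Finset.sum_nonneg fun _ _ => abs_nonneg _
          nlinarith
    obtain ⟨σ, hσ⟩ := hσ
    intro y hy
    have := le_of_forall_le (α := -σ) (β := 1) (γ := M - σ * i)
      (fun p hp => by linarith [hσ p hp]) hy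
    simp only at this
    linarith

/-- Reflection in the horizontal axis transfers results on the upper boundary to the lower one. -/
theorem mem_map_neg {x y : ℝ} :
    (x, y) ∈ latticePolygon (S.image fun p => (p.1, -p.2)) ↔ (x, -y) ∈ latticePolygon S := by
  have key : ∀ (S : Finset (ℤ × ℤ)) (x y : ℝ), (x, y) ∈ latticePolygon S →
      (x, -y) ∈ latticePolygon (S.image fun p => (p.1, -p.2)) := by
    intro S x y h
    have := Set.mem_image_of_mem (LinearMap.prodMap (LinearMap.id : ℝ →ₗ[ℝ] ℝ)
      (-LinearMap.id : ℝ →ₗ[ℝ] ℝ)) h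
    rw [latticePolygon, LinearMap.image_convexHull] at this
    simpa [latticePolygon, Set.image_image] using this
  refine ⟨fun h => ?_, fun h => ?_⟩
  · have := key _ _ _ h
    rwa [Finset.image_image, Finset.image_congr (g := id), Finset.image_id] at this
    intro p _
    simp
  · simpa using key _ _ _ h

theorem exists_rat_bot (i : ℤ) (hl : ∃ p ∈ S, p.1 ≤ i) (hr : ∃ q ∈ S, i ≤ q.1) :
    ∃ M : ℚ, ((i : ℝ), (M : ℝ)) ∈ latticePolygon S ∧
      ∀ y : ℝ, ((i : ℝ), y) ∈ latticePolygon S → (M : ℝ) ≤ y := by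
  obtain ⟨p, hp, hpi⟩ := hl
  obtain ⟨q, hq, hqi⟩ := hr
  obtain ⟨M, h1, h2⟩ := exists_rat_top (S := S.image fun p => (p.1, -p.2)) i
    ⟨_, Finset.mem_image_of_mem _ hp, hpi⟩ ⟨_, Finset.mem_image_of_mem _ hq, hqi⟩
  rw [mem_map_neg] at h1
  refine ⟨-M, by push_cast; exact h1, fun y hy => ?_⟩
  have := h2 (-y) (mem_map_neg.2 (by rwa [neg_neg]))
  push_cast
  linarith

/-- No point of `S` lies strictly between two consecutive integral columns. A point of `S` to the
left and above the line, joined to the top of column `i + 1`, would cross column `i` above its top;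
the right side is symmetric. -/
theorem le_chord {i : ℤ} {M M' : ℝ} (h : ((i : ℝ), M) ∈ latticePolygon S)
    (h' : ((i : ℝ) + 1, M') ∈ latticePolygon S)
    (hM : ∀ y : ℝ, ((i : ℝ), y) ∈ latticePolygon S → y ≤ M)
    (hM' : ∀ y : ℝ, ((i : ℝ) + 1, y) ∈ latticePolygon S → y ≤ M')
    {x y : ℝ} (hxy : (x, y) ∈ latticePolygon S) : y ≤ M + (M' - M) * (x - i) := by
  have : ∀ p ∈ S, -(M' - M) * (p.1 : ℝ) + 1 * (p.2 : ℝ) ≤ M - (M' - M) * i := by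
    intro p hp
    rcases le_or_gt p.1 i with hpi | hpi
    · have hpi' : (p.1 : ℝ) ≤ i := by exact_mod_cast hpi
      have hpos : (0 : ℝ) < i + 1 - p.1 := by linarith
      have hmem := mem_interp h' (mem_of_mem hp) (t := 1 / (i + 1 - p.1)) (by positivity)
        (by rw [div_le_one hpos]; linarith)
      have e : (i : ℝ) + 1 + 1 / (i + 1 - p.1) * (p.1 - (i + 1)) = i := by
        field_simp
        ring
      rw [e] at hmem
      have := hM _ hmem
      rw [div_mul_eq_mul_div, ← le_sub_iff_add_le', div_le_iff₀ hpos] at this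
      linarith
    · have hpi' : (i : ℝ) + 1 ≤ p.1 := by exact_mod_cast hpi
      have hpos : (0 : ℝ) < p.1 - i := by linarith
      have hmem := mem_interp h (mem_of_mem hp) (t := 1 / (p.1 - i)) (by positivity)
        (by rw [div_le_one hpos]; linarith)
      rw [one_div_mul_cancel hpos.ne'] at hmem
      have := hM' _ hmem
      rw [div_mul_eq_mul_div, ← le_sub_iff_add_le', div_le_iff₀ hpos] at this
      linarith
  have := le_of_forall_le this hxy
  simp only at this
  linarith

theorem chord_le {i : ℤ} {M M' : ℝ} (h : ((i : ℝ), M) ∈ latticePolygon S)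
    (h' : ((i : ℝ) + 1, M') ∈ latticePolygon S)
    (hM : ∀ y : ℝ, ((i : ℝ), y) ∈ latticePolygon S → M ≤ y)
    (hM' : ∀ y : ℝ, ((i : ℝ) + 1, y) ∈ latticePolygon S → M' ≤ y)
    {x y : ℝ} (hxy : (x, y) ∈ latticePolygon S) : M + (M' - M) * (x - i) ≤ y := by
  have := le_chord (S := S.image fun p => (p.1, -p.2)) (i := i) (M := -M) (M' := -M')
    (x := x) (y := -y) (by rwa [mem_map_neg, neg_neg]) (by rwa [mem_map_neg, neg_neg])
    (fun y hy => by rw [mem_map_neg] at hy; linarith [hM _ hy])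
    (fun y hy => by rw [mem_map_neg] at hy; linarith [hM' _ hy]) (by rwa [mem_map_neg, neg_neg])
  linarith

theorem exists_isTrapezoidal (hS : S.Nonempty) : ∃ (d : ℕ) (A : ℤ) (m : ℕ) (Y Z : ℕ → ℤ),
    IsTrapezoidal ((d : ℝ) • latticePolygon S) d A m Y Z := by
  obtain ⟨p, hp, hpmin⟩ := Finset.exists_min_image S Prod.fst hS
  obtain ⟨q, hq, hqmax⟩ := Finset.exists_max_image S Prod.fst hS
  set a := p.1
  obtain ⟨m, hm⟩ := Int.le.dest (hpmin q hq)
  have htop : ∀ j : ℕ, ∃ M : ℚ, j ≤ m → ((a : ℝ) + j, (M : ℝ)) ∈ latticePolygon S ∧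
      ∀ y : ℝ, ((a : ℝ) + j, y) ∈ latticePolygon S → y ≤ M := by
    intro j
    by_cases hj : j ≤ m
    · obtain ⟨M, hM⟩ := exists_rat_top (S := S) (a + j) ⟨p, hp, by omega⟩ ⟨q, hq, by omega⟩
      push_cast at hM
      exact ⟨M, fun _ => hM⟩
    · exact ⟨0, fun h => absurd h hj⟩
  have hbot : ∀ j : ℕ, ∃ M : ℚ, j ≤ m → ((a : ℝ) + j, (M : ℝ)) ∈ latticePolygon S ∧
      ∀ y : ℝ, ((a : ℝ) + j, y) ∈ latticePolygon S → (M : ℝ) ≤ y := by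
    intro j
    by_cases hj : j ≤ m
    · obtain ⟨M, hM⟩ := exists_rat_bot (S := S) (a + j) ⟨p, hp, by omega⟩ ⟨q, hq, by omega⟩
      push_cast at hM
      exact ⟨M, fun _ => hM⟩
    · exact ⟨0, fun h => absurd h hj⟩
  choose M hM using htop
  choose N hN using hbot
  -- Clears the denominators of all column tops and bottoms; dilation by `d` also spreads the unit
  -- columns to spacing `d`.
  set d : ℕ := ∏ j ∈ Finset.range (m + 1), (M j).den * (N j).den with hd
  have hdpos : 0 < d := Finset.prod_pos fun j _ => Nat.mul_pos (M j).den_pos (N j).den_pos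
  have hd' : (0 : ℝ) < d := by exact_mod_cast hdpos
  have hint : ∀ r : ℚ, r.den ∣ d → ∃ z : ℤ, (z : ℝ) = d * r := by
    rintro r ⟨e, he⟩
    refine ⟨r.num * e, ?_⟩
    rw [he]
    have := Rat.mul_den_eq_num r
    have : (r : ℝ) * r.den = r.num := by exact_mod_cast this
    push_cast
    rw [← this]; ring
  have hY : ∀ j : ℕ, ∃ z : ℤ, j ≤ m → (z : ℝ) = d * M j := by
    intro j
    by_cases hj : j ≤ m
    · obtain ⟨z, hz⟩ := hint (M j) ((Dvd.intro _ rfl).trans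
        (Finset.dvd_prod_of_mem _ (Finset.mem_range.2 (Nat.lt_succ_of_le hj))))
      exact ⟨z, fun _ => hz⟩
    · exact ⟨0, fun h => absurd h hj⟩
  have hZ : ∀ j : ℕ, ∃ z : ℤ, j ≤ m → (z : ℝ) = d * N j := by
    intro j
    by_cases hj : j ≤ m
    · obtain ⟨z, hz⟩ := hint (N j) ((Dvd.intro_left _ rfl).trans
        (Finset.dvd_prod_of_mem _ (Finset.mem_range.2 (Nat.lt_succ_of_le hj))))
      exact ⟨z, fun _ => hz⟩
    · exact ⟨0, fun h => absurd h hj⟩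
  choose Y hY using hY
  choose Z hZ using hZ
  have hmem : ∀ x y : ℝ, (x, y) ∈ (d : ℝ) • latticePolygon S ↔
      (x / d, y / d) ∈ latticePolygon S := by
    intro x y
    rw [Set.mem_smul_set_iff_inv_smul_mem₀ hd'.ne']
    simp [Prod.smul_mk, smul_eq_mul, div_eq_inv_mul]
  have hvert : ∀ x y y₁ y₂ : ℝ, (x, y₁) ∈ latticePolygon S → (x, y₂) ∈ latticePolygon S →
      y₁ ≤ y → y ≤ y₂ → (x, y) ∈ latticePolygon S := by
    intro x y y₁ y₂ h1 h2 h3 h4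
    rcases (h3.trans h4).eq_or_lt with h | h
    · rwa [le_antisymm (h4.trans h.ge) h3]
    · have hpos := sub_pos.2 h
      have := mem_interp h1 h2 (t := (y - y₁) / (y₂ - y₁)) (div_nonneg (by linarith) hpos.le)
        (by rw [div_le_one hpos]; linarith)
      rw [div_mul_cancel₀ _ hpos.ne'] at this
      simpa using this
  refine ⟨d, d * a, m, Y, Z, hdpos, fun j hj => ?_, fun y => ?_, fun z hz => ?_,
    fun j hj x y h1 h2 => ?_⟩
  · have : (Z j : ℝ) ≤ Y j := by
      rw [hY j hj, hZ j hj]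
      exact mul_le_mul_of_nonneg_left ((hN j hj).2 _ (hM j hj).1) hd'.le
    exact_mod_cast this
  · have e : ((d * a : ℤ) : ℝ) / d = a := by push_cast; field_simp
    rw [hmem, e, hY 0 (Nat.zero_le _), hZ 0 (Nat.zero_le _), ← le_div_iff₀' hd',
      ← div_le_iff₀' hd']
    have hM0 := hM 0 (Nat.zero_le _)
    have hN0 := hN 0 (Nat.zero_le _)
    simp only [Nat.cast_zero, add_zero] at hM0 hN0
    exact ⟨fun h => ⟨hN0.2 _ h, hM0.2 _ h⟩, fun h => hvert _ _ _ _ hN0.1 hM0.1 h.1 h.2⟩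
  · obtain ⟨x, y⟩ := z
    rw [hmem] at hz
    have h1 := le_of_forall_le (α := -1) (β := 0) (γ := -a)
      (fun p hp => by
        have : (a : ℝ) ≤ p.1 := by exact_mod_cast hpmin p hp
        linarith) hz
    have h2 := le_of_forall_le (α := 1) (β := 0) (γ := a + m)
      (fun p hp => by
        have : p.1 ≤ a + m := by rw [hm]; exact hqmax p hp
        have : (p.1 : ℝ) ≤ a + m := by exact_mod_cast this
        linarith) hz
    simp only [neg_mul, one_mul, zero_mul, add_zero, neg_le_neg_iff] at h1 h2
    rw [le_div_iff₀ hd'] at h1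
    rw [div_le_iff₀ hd'] at h2
    push_cast
    constructor <;> linarith
  · rw [hmem]
    push_cast at h1 h2
    obtain ⟨M1, M2⟩ := hM j hj.le
    obtain ⟨M1', M2'⟩ := hM (j + 1) hj
    obtain ⟨N1, N2⟩ := hN j hj.le
    obtain ⟨N1', N2'⟩ := hN (j + 1) hj
    have e : (a : ℝ) + ((j + 1 : ℕ) : ℝ) = ((a + j : ℤ) : ℝ) + 1 := by push_cast; ring
    have e' : (a : ℝ) + j = ((a + j : ℤ) : ℝ) := by push_cast; ring
    rw [e] at M1' N1'
    rw [e'] at M1 N1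
    simp only [e] at M2' N2'
    simp only [e'] at M2 N2
    rw [hY j hj.le, hY (j + 1) hj, hZ j hj.le, hZ (j + 1) hj]
    have conv : ∀ r r' : ℝ, d * r + (d * r' - d * r) / d * (x - ((d * a + j * d : ℤ) : ℝ)) =
        d * (r + (r' - r) * (x / d - ((a + j : ℤ) : ℝ))) := by
      intro r r'
      push_cast
      field_simp
    rw [conv, conv, ← le_div_iff₀' hd', ← div_le_iff₀' hd']
    refine ⟨fun h => ⟨chord_le N1 N1' N2 N2' h, le_chord M1 M1' M2 M2' h⟩, fun h => ?_⟩
    have t0 : 0 ≤ x / d - ((a + j : ℤ) : ℝ) := by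
      rw [sub_nonneg, le_div_iff₀ hd']; push_cast; linarith
    have t1 : x / d - ((a + j : ℤ) : ℝ) ≤ 1 := by
      rw [sub_le_iff_le_add, div_le_iff₀ hd']; push_cast; linarith
    have top := mem_interp M1 M1' t0 t1
    have bot := mem_interp N1 N1' t0 t1
    have ex : ((a + j : ℤ) : ℝ) + (x / d - ((a + j : ℤ) : ℝ)) *
        (((a + j : ℤ) : ℝ) + 1 - ((a + j : ℤ) : ℝ)) = x / d := by ring
    rw [ex] at top bot
    exact hvert _ _ _ _ bot top (by linarith [h.1]) (by linarith [h.2])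

end latticePolygon

/-! ### Reduction to the plane -/

theorem integralLattice_add {n : ℕ} {x y : Fin n → ℝ} (hx : x ∈ integralLattice n)
    (hy : y ∈ integralLattice n) : x + y ∈ integralLattice n := fun j => by
  obtain ⟨a, ha⟩ := hx j
  obtain ⟨b, hb⟩ := hy j
  exact ⟨a + b, by simp [ha, hb]⟩

theorem integralLattice_int_smul {n : ℕ} {x : Fin n → ℝ} (hx : x ∈ integralLattice n) (k : ℤ) :
    (k : ℝ) • x ∈ integralLattice n := fun j => by
  obtain ⟨a, ha⟩ := hx j
  exact ⟨k * a, by simp [ha]⟩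

theorem integralLattice_sub {n : ℕ} {x y : Fin n → ℝ} (hx : x ∈ integralLattice n)
    (hy : y ∈ integralLattice n) : x - y ∈ integralLattice n := fun j => by
  obtain ⟨a, ha⟩ := hx j
  obtain ⟨b, hb⟩ := hy j
  exact ⟨a - b, by simp [ha, hb]⟩

/-- A rational plane has a parametrization under which its lattice points correspond to `ℤ²`. -/
theorem exists_lattice_parametrization {n : ℕ} (U : Submodule ℝ (Fin n → ℝ))
    (hU : Module.finrank ℝ U = 2) (hspan : U ≤ Submodule.span ℝ (U ∩ integralLattice n)) :
    ∃ B : (ℝ × ℝ) →ₗ[ℝ] (Fin n → ℝ), Function.Injective B ∧ LinearMap.range B = U ∧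
      ∀ z, B z ∈ integralLattice n ↔ ∃ w : ℤ × ℤ, z = ((w.1 : ℝ), (w.2 : ℝ)) := by
  set L := Submodule.span ℤ (Set.range (Pi.basisFun ℝ (Fin n)))
  have hL : ∀ x, x ∈ L ↔ x ∈ integralLattice n := by
    intro x
    rw [Module.Basis.mem_span_iff_repr_mem]
    simp [integralLattice, eq_comm]
  -- The integral points of `U` form a discrete subgroup, of full rank by `hspan`; a `ℤ`-basis of it
  -- is then an `ℝ`-basis of `U`.
  set L' := ZLattice.comap ℝ L U.subtype with hL'
  have : DiscreteTopology L' :=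
    ZLattice.comap_discreteTopology ℝ L continuous_subtype_val Subtype.val_injective
  have : IsZLattice ℝ L' := by
    constructor
    apply Submodule.map_injective_of_injective U.subtype_injective
    rw [Submodule.map_span, Submodule.map_top, Submodule.range_subtype]
    have : U.subtype '' (L' : Set U) = (U : Set (Fin n → ℝ)) ∩ integralLattice n := by
      ext x
      simp only [hL', ZLattice.coe_comap, Set.mem_image, Set.mem_preimage, SetLike.mem_coe, hL,
        Submodule.coe_subtype]
      constructor
      · rintro ⟨y, hy, rfl⟩
        exact ⟨y.2, hy⟩
      · rintro ⟨h1, h2⟩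
        exact ⟨⟨x, h1⟩, h2, rfl⟩
    rw [this]
    refine le_antisymm (Submodule.span_le.2 Set.inter_subset_left) hspan
  have := ZLattice.module_finite ℝ L'
  have := ZLattice.module_free ℝ L'
  let b : Module.Basis (Fin 2) ℤ L' := (Module.Free.chooseBasis ℤ L').reindex
    (Fintype.equivFinOfCardEq (by
      rw [← Module.finrank_eq_card_chooseBasisIndex, ZLattice.rank ℝ, hU]))
  let bR := b.ofZLatticeBasis ℝ L'
  let e : (ℝ × ℝ) ≃ₗ[ℝ] U := (LinearEquiv.finTwoArrow ℝ ℝ).symm ≪≫ₗ bR.equivFun.symm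
  refine ⟨U.subtype ∘ₗ e.toLinearMap, U.subtype_injective.comp e.injective, ?_, fun z => ?_⟩
  · rw [LinearMap.range_comp, LinearEquiv.range, Submodule.map_top, Submodule.range_subtype]
  · have h1 : (U.subtype ∘ₗ e.toLinearMap) z ∈ integralLattice n ↔ e z ∈ L' := by
      rw [← hL]; rfl
    have h2 : ∀ i, bR.repr (e z) i = (LinearEquiv.finTwoArrow ℝ ℝ).symm z i := by
      intro i
      have : bR.equivFun (e z) = (LinearEquiv.finTwoArrow ℝ ℝ).symm z :=
        bR.equivFun.apply_symm_apply _
      rw [← this, Module.Basis.equivFun_apply]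
    rw [h1, ← b.ofZLatticeBasis_span ℝ L', Module.Basis.mem_span_iff_repr_mem]
    change (∀ i, bR.repr (e z) i ∈ _) ↔ _
    simp only [h2, Fin.forall_fin_two, LinearEquiv.finTwoArrow_symm_apply]
    obtain ⟨x, y⟩ := z
    simp [eq_comm]

theorem exists_nat_smul_mem_integralLattice {n : ℕ} {x : Fin n → ℝ} (hx : x ∈ rationalPoints n) :
    ∃ N : ℕ, 0 < N ∧ (N : ℝ) • x ∈ integralLattice n := by
  choose q hq using hx
  refine ⟨∏ j, (q j).den, Finset.prod_pos fun j _ => (q j).den_pos, fun j => ?_⟩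
  obtain ⟨e, he⟩ := Finset.dvd_prod_of_mem (fun j => (q j).den) (Finset.mem_univ j)
  refine ⟨(q j).num * e, ?_⟩
  have : ((q j : ℚ) : ℝ) * (q j).den = (q j).num := by exact_mod_cast Rat.mul_den_eq_num (q j)
  rw [Pi.smul_apply, smul_eq_mul, he, hq j]
  push_cast
  rw [← this]
  ring

theorem exists_nat_forall_smul_mem_integralLattice {n : ℕ} {V : Set (Fin n → ℝ)} (hV : V.Finite)
    (h : V ⊆ rationalPoints n) :
    ∃ N : ℕ, 0 < N ∧ ∀ x ∈ V, (N : ℝ) • x ∈ integralLattice n := by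
  induction V, hV using Set.Finite.induction_on with
  | empty => exact ⟨1, one_pos, by simp⟩
  | @insert a s _ _ ih =>
    obtain ⟨N, hN, h1⟩ := ih ((Set.subset_insert _ _).trans h)
    obtain ⟨M, hM, h2⟩ := exists_nat_smul_mem_integralLattice (h (Set.mem_insert _ _))
    refine ⟨N * M, Nat.mul_pos hN hM, ?_⟩
    rintro x (rfl | hx)
    · have := integralLattice_int_smul h2 N
      rw [smul_smul] at this
      simpa using this
    · have := integralLattice_int_smul (h1 x hx) M
      rw [smul_smul, mul_comm] at this
      simpa using this

theorem IsPolytope.finite_extremePoints {n : ℕ} {P : Set (Fin n → ℝ)} (hP : IsPolytope P) :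
    (P.extremePoints ℝ).Finite := by
  obtain ⟨s, hs, rfl⟩ := hP
  exact hs.subset extremePoints_convexHull_subset

theorem IsPolytope.convexHull_extremePoints {n : ℕ} {P : Set (Fin n → ℝ)} (hP : IsPolytope P) :
    convexHull ℝ (P.extremePoints ℝ) = P := by
  have hfin := hP.finite_extremePoints
  obtain ⟨s, hs, rfl⟩ := hP
  have := closure_convexHull_extremePoints (hs.isCompact_convexHull ℝ) (convex_convexHull ℝ s)
  rwa [(hfin.isClosed_convexHull ℝ).closure_eq] at this

/-- A two-dimensional rational polytope, up to an integral dilation, is the image of a lattice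
polygon under a lattice-preserving affine parametrization of its affine hull. -/
theorem exists_latticePolygon_parametrization {n : ℕ} {P : Set (Fin n → ℝ)}
    (hP : IsRationalPolytope P) (hdim : setDim P = 2) :
    ∃ (S : Finset (ℤ × ℤ)) (N : ℕ) (B : (ℝ × ℝ) →ₗ[ℝ] (Fin n → ℝ)) (v₀ : Fin n → ℝ),
      S.Nonempty ∧ 0 < N ∧ Function.Injective B ∧ (N : ℝ) • v₀ ∈ integralLattice n ∧
      (∀ z, B z ∈ integralLattice n ↔ ∃ w : ℤ × ℤ, z = ((w.1 : ℝ), (w.2 : ℝ))) ∧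
      ∀ x, x ∈ P ↔ ∃ z ∈ latticePolygon S, x = v₀ + (N : ℝ)⁻¹ • B z := by
  classical
  set V := P.extremePoints ℝ with hV
  have hVfin : V.Finite := hP.1.finite_extremePoints
  have hPV : convexHull ℝ V = P := hP.1.convexHull_extremePoints
  set U := vectorSpan ℝ V with hU
  have hfin : Module.finrank ℝ U = 2 := by
    rw [← hdim, setDim, ← hPV, affineSpan_convexHull, direction_affineSpan]
  obtain ⟨v₀, hv₀⟩ : V.Nonempty := by
    by_contra h
    rw [Set.not_nonempty_iff_eq_empty] at h
    rw [hU, h, vectorSpan_empty, finrank_bot] at hfin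
    omega
  obtain ⟨N, hN, hNV⟩ := exists_nat_forall_smul_mem_integralLattice hVfin hP.2
  have hN' : (N : ℝ) ≠ 0 := by positivity
  have hdiff : ∀ v ∈ V, (N : ℝ) • (v - v₀) ∈ (U : Set (Fin n → ℝ)) ∩ integralLattice n := by
    intro v hv
    refine ⟨U.smul_mem _ (vsub_mem_vectorSpan ℝ hv hv₀), ?_⟩
    rw [smul_sub]
    exact integralLattice_sub (hNV v hv) (hNV v₀ hv₀)
  obtain ⟨B, hBinj, hBrange, hB⟩ := exists_lattice_parametrization U hfin (by
    conv_lhs => rw [hU, vectorSpan_eq_span_vsub_set_right ℝ hv₀]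
    rw [Submodule.span_le]
    rintro _ ⟨v, hv, rfl⟩
    have := Submodule.smul_mem _ (N : ℝ)⁻¹ (Submodule.subset_span (R := ℝ) (hdiff v hv))
    rwa [smul_smul, inv_mul_cancel₀ hN', one_smul] at this)
  have hw : ∀ v : V, ∃ w : ℤ × ℤ, B ((w.1 : ℝ), (w.2 : ℝ)) = (N : ℝ) • (v.1 - v₀) := by
    intro v
    obtain ⟨h1, h2⟩ := hdiff v v.2
    rw [← hBrange] at h1
    obtain ⟨z, hz⟩ := h1
    rw [← hz, hB] at h2
    obtain ⟨w, rfl⟩ := h2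
    exact ⟨w, hz⟩
  choose w hw using hw
  have := hVfin.fintype
  refine ⟨Finset.univ.image w, N, B, v₀, ⟨w ⟨v₀, hv₀⟩, by simp⟩, hN, hBinj, hNV v₀ hv₀, hB, ?_⟩
  let F : (ℝ × ℝ) →ᵃ[ℝ] (Fin n → ℝ) :=
    ((N : ℝ)⁻¹ • B).toAffineMap + AffineMap.const ℝ (ℝ × ℝ) v₀
  have hF : ∀ z, F z = v₀ + (N : ℝ)⁻¹ • B z := by
    intro z
    simp [F, add_comm]
  have hFV : F '' ((fun p : ℤ × ℤ => ((p.1 : ℝ), (p.2 : ℝ))) '' (Finset.univ.image w : Finset _)) =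
      V := by
    have hFw : ∀ v : V, F (((w v).1 : ℝ), ((w v).2 : ℝ)) = v.1 := by
      intro v
      rw [hF, hw, smul_smul, inv_mul_cancel₀ hN', one_smul, add_sub_cancel]
    ext x
    constructor
    · rintro ⟨_, ⟨p, hp, rfl⟩, rfl⟩
      simp only [Finset.coe_image, Finset.coe_univ, Set.image_univ, Set.mem_range] at hp
      obtain ⟨v, rfl⟩ := hp
      rw [hFw]
      exact v.2
    · intro hx
      exact ⟨_, ⟨w ⟨x, hx⟩, by simp, rfl⟩, hFw ⟨x, hx⟩⟩
  intro x
  have himg : F '' latticePolygon (Finset.univ.image w) = P := by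
    rw [latticePolygon, AffineMap.image_convexHull, hFV, hPV]
  have hxP : x ∈ P ↔ x ∈ F '' latticePolygon (Finset.univ.image w) := by rw [himg]
  rw [hxP]
  constructor
  · rintro ⟨z, hz, rfl⟩
    exact ⟨z, hz, hF z⟩
  · rintro ⟨z, hz, rfl⟩
    exact ⟨z, hz, hF z⟩

/-- The lattice points in the dilates of a rational polygon, along an arithmetic progression of
dilation factors, are either always absent, or are counted by a planar lattice polygon. -/
theorem exists_planar_count {n : ℕ} {P : Set (Fin n → ℝ)}
    (hP : IsRationalPolytope P) (hdim : setDim P = 2) :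
    ∃ (S : Finset (ℤ × ℤ)) (N : ℕ), S.Nonempty ∧ 0 < N ∧ ∀ r : ℝ,
      (r ≠ 0 ∧ ∀ k : ℕ, (((r + k * N : ℝ) • P) ∩ integralLattice n).ncard = 0) ∨
      ∃ u v : ℝ, (r = 0 → u = 0 ∧ v = 0) ∧ ∀ k : ℕ,
        (((r + k * N : ℝ) • P) ∩ integralLattice n).ncard =
          {z : ℤ × ℤ | ((z.1 : ℝ) - u, (z.2 : ℝ) - v) ∈
            ((r + k * N) / N : ℝ) • latticePolygon S}.ncard := by
  obtain ⟨S, N, B, v₀, hS, hN, hBinj, hv₀, hB, hmem⟩ :=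
    exists_latticePolygon_parametrization hP hdim
  refine ⟨S, N, hS, hN, fun r => ?_⟩
  have hN' : (N : ℝ) ≠ 0 := by positivity
  have hkv : ∀ k : ℕ, (k * N : ℝ) • v₀ ∈ integralLattice n := by
    intro k
    have := integralLattice_int_smul hv₀ k
    rwa [smul_smul, Int.cast_natCast] at this
  have hdil : ∀ (t : ℝ) x, x ∈ t • P ↔ ∃ z ∈ latticePolygon S, x = t • v₀ + B ((t / N) • z) := by
    intro t x
    rw [Set.mem_smul_set]
    constructor
    · rintro ⟨y, hy, rfl⟩
      obtain ⟨z, hz, rfl⟩ := (hmem y).1 hy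
      exact ⟨z, hz, by rw [smul_add, map_smul, smul_smul, div_eq_mul_inv]⟩
    · rintro ⟨z, hz, rfl⟩
      exact ⟨_, (hmem _).2 ⟨z, hz, rfl⟩, by rw [smul_add, map_smul, smul_smul, div_eq_mul_inv]⟩
  -- Asks whether the affine plane of `rP` contains a lattice point `p`; `w` is then the offset of
  -- `r • v₀` in lattice coordinates. As `N • v₀` is integral, the answer and the offset serve every
  -- `r + k N`. The last clause forces offset `0` at `r = 0`, where equality in the bound is needed.
  by_cases hex : ∃ p ∈ integralLattice n, ∃ w, B w = r • v₀ - p ∧ (r = 0 → p = 0)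
  · right
    obtain ⟨p, hp, ⟨u, v⟩, hw, hr⟩ := hex
    refine ⟨u, v, ?_, fun k => ?_⟩
    · rintro rfl
      rw [hr rfl, zero_smul, sub_zero, ← map_zero B] at hw
      have := hBinj hw
      simpa using this
    · set t := r + k * N with ht
      set pk := p + (k * N : ℝ) • v₀ with hpk
      have hpk' : pk ∈ integralLattice n := integralLattice_add hp (hkv k)
      have htv : t • v₀ = pk + B (u, v) := by
        rw [hw, ht, hpk, add_smul]
        abel
      set Φ : ℤ × ℤ → (Fin n → ℝ) := fun z => pk + B ((z.1 : ℝ), (z.2 : ℝ)) with hΦ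
      have hΦinj : Function.Injective Φ := by
        intro a b hab
        have := hBinj (add_left_cancel hab)
        simpa [Prod.ext_iff] using this
      rw [← Set.ncard_image_of_injective _ hΦinj]
      congr 1
      ext x
      constructor
      · rintro ⟨h1, h2⟩
        obtain ⟨z, hz, rfl⟩ := (hdil t x).1 h1
        rw [htv, add_assoc, ← map_add] at h2 ⊢
        have h3 := integralLattice_sub h2 hpk'
        rw [add_sub_cancel_left, hB] at h3
        obtain ⟨w, hw⟩ := h3
        refine ⟨w, ?_, by rw [hΦ, hw]⟩
        have : ((w.1 : ℝ) - u, (w.2 : ℝ) - v) = (t / N) • z := by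
          have e : ((w.1 : ℝ) - u, (w.2 : ℝ) - v) = ((w.1 : ℝ), (w.2 : ℝ)) - (u, v) := rfl
          rw [e, ← hw, add_sub_cancel_left]
        rw [Set.mem_ofPred_eq, this]
        exact Set.smul_mem_smul_set hz
      · rintro ⟨w, ⟨z, hz, hzw⟩, rfl⟩
        refine ⟨(hdil t _).2 ⟨z, hz, ?_⟩, integralLattice_add hpk' ((hB _).2 ⟨w, rfl⟩)⟩
        simp only at hzw
        rw [hΦ, htv, add_assoc, ← map_add, hzw]
        simp
  · left
    refine ⟨?_, fun k => ?_⟩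
    · rintro rfl
      exact hex ⟨0, fun j => ⟨0, by simp⟩, 0, by simp, fun _ => rfl⟩
    · suffices h : ((r + k * N : ℝ) • P) ∩ integralLattice n = ∅ by rw [h, Set.ncard_empty]
      rw [Set.eq_empty_iff_forall_notMem]
      rintro x ⟨h1, h2⟩
      have hr : r ≠ 0 := by
        rintro rfl
        exact hex ⟨0, fun j => ⟨0, by simp⟩, 0, by simp, fun _ => rfl⟩
      obtain ⟨z, hz, rfl⟩ := (hdil _ _).1 h1
      refine hex ⟨_, integralLattice_sub h2 (hkv k), -(((r + k * N) / N : ℝ) • z), ?_,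
        fun h => absurd h hr⟩
      rw [map_neg, add_smul]
      abel

/-! ### The rational denominator -/

theorem smul_extremePoints {n : ℕ} {P : Set (Fin n → ℝ)} {s : ℝ} (hs : s ≠ 0) :
    (s • P).extremePoints ℝ = s • P.extremePoints ℝ :=
  (image_extremePoints (LinearEquiv.smulOfNeZero ℝ (Fin n → ℝ) s hs) P).symm

theorem IsPolytope.isIntegralPolytope_smul_iff {n : ℕ} {P : Set (Fin n → ℝ)} (hP : IsPolytope P)
    {s : ℝ} (hs : s ≠ 0) :
    IsIntegralPolytope (s • P) ↔ ∀ v ∈ P.extremePoints ℝ, s • v ∈ integralLattice n := by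
  rw [IsIntegralPolytope, smul_extremePoints hs]
  constructor
  · intro h v hv
    exact h.2 (Set.smul_mem_smul_set hv)
  · intro h
    refine ⟨?_, ?_⟩
    · obtain ⟨t, ht, rfl⟩ := hP
      exact ⟨s • t, ht.image _, (convexHull_smul s t).symm⟩
    · rintro _ ⟨v, hv, rfl⟩
      exact h v hv

/-- Some vertex has a nonzero coordinate `v j`, and every admissible `s` makes `s * |v j|` a natural
number, so the minimum exists by well-ordering. Positive dimension excludes `P = {0}`, for which
every `s > 0` is admissible. -/
theorem exists_isRationalDenominator {n : ℕ} {P : Set (Fin n → ℝ)} (hP : IsRationalPolytope P)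
    (hdim : setDim P ≠ 0) : ∃ q : ℚ≥0, IsRationalDenominator P q := by
  obtain ⟨v, hv, j, hj⟩ : ∃ v ∈ P.extremePoints ℝ, ∃ j, v j ≠ 0 := by
    by_contra! h
    apply hdim
    have hsub : P.extremePoints ℝ ⊆ {0} := fun v hv => funext fun j => h v hv j
    rw [setDim, ← hP.1.convexHull_extremePoints, affineSpan_convexHull, direction_affineSpan,
      (vectorSpan_eq_bot_iff_subsingleton ℝ).2 (Set.subsingleton_singleton.anti hsub), finrank_bot]
  obtain ⟨N, hN, hNV⟩ := exists_nat_forall_smul_mem_integralLattice hP.1.finite_extremePoints hP.2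
  set X := {s : ℚ≥0 | 0 < s ∧ IsIntegralPolytope ((s : ℝ) • P)} with hX
  have hne : X.Nonempty := by
    refine ⟨N, by exact_mod_cast hN, ?_⟩
    rw [hP.1.isIntegralPolytope_smul_iff (by positivity)]
    simpa using hNV
  have hint : ∀ s ∈ X, ((⌊(s : ℝ) * |v j|⌋₊ : ℕ) : ℝ) = s * |v j| := by
    rintro s ⟨hs, hsP⟩
    have hs' : (0 : ℝ) < s := by exact_mod_cast hs
    obtain ⟨z, hz⟩ := (hP.1.isIntegralPolytope_smul_iff hs'.ne').1 hsP v hv j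
    have e : (s : ℝ) * |v j| = ((z.natAbs : ℕ) : ℝ) := by
      rw [Nat.cast_natAbs, Int.cast_abs, ← hz, Pi.smul_apply, smul_eq_mul, abs_mul,
        abs_of_pos hs']
    rw [e, Nat.floor_natCast]
  obtain ⟨q, hq, hmin⟩ := (measure fun s : ℚ≥0 => ⌊(s : ℝ) * |v j|⌋₊).wf.has_min X hne
  refine ⟨q, hq, fun s hs => ?_⟩
  have h1 : ⌊(q : ℝ) * |v j|⌋₊ ≤ ⌊(s : ℝ) * |v j|⌋₊ := not_lt.1 (hmin s hs)
  have h2 : (q : ℝ) * |v j| ≤ s * |v j| := by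
    rw [← hint q hq, ← hint s hs]
    exact_mod_cast h1
  exact_mod_cast le_of_mul_le_mul_right h2 (abs_pos.2 hj)

/-! ### From counts to coefficient functions -/

theorem quadratic_coeff_unique {K : Type*} [Field K] [CharZero K] {a b c a' b' c' r D : K}
    (hD : D ≠ 0)
    (h : ∀ k : ℕ, a * (r + k * D) ^ 2 + b * (r + k * D) + c =
      a' * (r + k * D) ^ 2 + b' * (r + k * D) + c') : a = a' ∧ b = b' ∧ c = c' := by
  have h0 := h 0
  have h1 := h 1
  have h2 := h 2
  push_cast at h0 h1 h2
  have ha : a = a' := by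
    have : (2 * D ^ 2) * a = (2 * D ^ 2) * a' := by linear_combination h2 - 2 * h1 + h0
    exact mul_left_cancel₀ (mul_ne_zero two_ne_zero (pow_ne_zero 2 hD)) this
  subst ha
  have hb : b = b' := by
    have : D * b = D * b' := by linear_combination h1 - h0
    exact mul_left_cancel₀ hD this
  subst hb
  exact ⟨rfl, rfl, by linear_combination h0⟩

/-- A real quadratic polynomial with rational values along a rational arithmetic progression
has rational coefficients. -/
theorem exists_rat_quadratic {a b c : ℝ} {r D : ℚ} (hD : D ≠ 0) {f : ℕ → ℚ}
    (h : ∀ k : ℕ, (f k : ℝ) = a * (r + k * D) ^ 2 + b * (r + k * D) + c) :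
    ∃ a' b' c' : ℚ, (b' : ℝ) = b ∧
      ∀ k : ℕ, f k = a' * (r + k * D) ^ 2 + b' * (r + k * D) + c' := by
  have hD' : (D : ℝ) ≠ 0 := by exact_mod_cast hD
  have h0 := h 0
  have h1 := h 1
  have h2 := h 2
  push_cast at h0 h1 h2
  -- Interpolation through three values: the second difference of the quadratic is `2 a D ^ 2`.
  set a' : ℚ := (f 2 - 2 * f 1 + f 0) / (2 * D ^ 2) with ha'
  set b' : ℚ := (f 1 - f 0) / D - a' * (2 * r + D) with hb'
  set c' : ℚ := f 0 - a' * r ^ 2 - b' * r with hc'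
  have ha : (a' : ℝ) = a := by
    rw [ha']
    push_cast
    rw [h0, h1, h2]
    field_simp
    ring
  have hb : (b' : ℝ) = b := by
    rw [hb']
    push_cast
    rw [ha, h0, h1]
    field_simp
    ring
  have hc : (c' : ℝ) = c := by
    rw [hc']
    push_cast
    rw [ha, hb, h0]
    ring
  refine ⟨a', b', c', hb, fun k => ?_⟩
  have : (f k : ℝ) = ((a' * (r + k * D) ^ 2 + b' * (r + k * D) + c' : ℚ) : ℝ) := by
    push_cast
    rw [ha, hb, hc, h k]
  exact_mod_cast this

theorem exists_latticeCount_quadratic {n : ℕ} {P : Set (Fin n → ℝ)} (hP : IsRationalPolytope P)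
    (hdim : setDim P = 2) : ∃ (D : ℕ) (β : ℝ), 0 < D ∧ ∀ r : ℚ≥0, ∃ a b c : ℝ,
      |b| ≤ β ∧ (r = 0 → b = β) ∧ ∀ k : ℕ, (latticeCount P (r + k * D) : ℝ) =
        a * (r + k * D) ^ 2 + b * (r + k * D) + c := by
  obtain ⟨S, N, hS, hN, hcount⟩ := exists_planar_count hP hdim
  obtain ⟨d, A, m, Y, Z, htrap⟩ := latticePolygon.exists_isTrapezoidal hS
  obtain ⟨a, b₀, hab⟩ := htrap.exists_count_eq
  have hd := htrap.pos
  have hN' : (0 : ℝ) < N := by exact_mod_cast hN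
  have hd' : (0 : ℝ) < d := by exact_mod_cast hd
  -- Needed for progressions without lattice points, where the zero polynomial is used.
  have hb₀ : 0 ≤ b₀ := by
    obtain ⟨b, c, h, -⟩ := hab 0 0 0 le_rfl
    exact (abs_nonneg b).trans h
  refine ⟨d * N, b₀ / (d * N), Nat.mul_pos hd hN, fun r => ?_⟩
  have hL : ∀ k : ℕ, latticeCount P (r + k * (d * N : ℕ)) =
      ((((r : ℝ) + (k * d : ℕ) * N : ℝ) • P) ∩ integralLattice n).ncard := by
    intro k
    rw [latticeCount]
    congr 3
    push_cast
    ring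
  rcases hcount r with ⟨hr, h0⟩ | ⟨u, v, huv, h⟩
  · refine ⟨0, 0, 0, by rw [abs_zero]; positivity, fun h => absurd (by simp [h]) hr, fun k => ?_⟩
    rw [hL, h0]
    simp
  · obtain ⟨b, c, hb, hb', hk⟩ := hab (r / (d * N)) u v (by positivity)
    refine ⟨a / (d * N) ^ 2, b / (d * N), c, ?_, ?_, fun k => ?_⟩
    · rw [abs_div, abs_of_pos (mul_pos hd' hN')]
      gcongr
    · rintro rfl
      obtain ⟨hu, hv⟩ := huv (by simp)
      rw [hb' (by simp) hu hv]
    -- Steps of `d * N` in `r` are unit steps in the dilation factor of the trapezoidal region.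
    · have e : (((r : ℝ) + (k * d : ℕ) * N) / N) • latticePolygon S =
          ((r : ℝ) / (d * N) + k) • ((d : ℝ) • latticePolygon S) := by
        rw [smul_smul]
        congr 1
        push_cast
        field_simp
      rw [hL, h, e, hk]
      push_cast
      field_simp

/-- The coefficients are chosen separately for each `r`. The progression from `r + D` is a tail of
the one from `r`, so uniqueness of the quadratic gives period `D`. -/
theorem exists_isRationalEhrhartExpansion {n : ℕ} {P : Set (Fin n → ℝ)}
    (hP : IsRationalPolytope P) (hdim : setDim P = 2) :
    ∃ c, IsRationalEhrhartExpansion P c ∧ ∀ r, |c 1 r| ≤ c 1 0 := by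
  obtain ⟨D, β, hD, h⟩ := exists_latticeCount_quadratic hP hdim
  have hD0 : (D : ℚ) ≠ 0 := by positivity
  have hrat : ∀ r : ℚ≥0, ∃ a b c : ℚ, |(b : ℝ)| ≤ β ∧ (r = 0 → (b : ℝ) = β) ∧
      ∀ k : ℕ, (latticeCount P (r + k * D) : ℚ) =
        a * ((r : ℚ) + k * D) ^ 2 + b * ((r : ℚ) + k * D) + c := by
    intro r
    obtain ⟨a, b, c, h1, h2, h3⟩ := h r
    obtain ⟨a', b', c', h4, h5⟩ := exists_rat_quadratic (r := r) (D := D) hD0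
      (f := fun k : ℕ => (latticeCount P (r + k * D) : ℚ)) (a := a) (b := b) (c := c) (by
        intro k
        rw [Rat.cast_natCast, h3]
        simp)
    exact ⟨a', b', c', h4 ▸ h1, h4 ▸ h2, h5⟩
  choose a b c hb hb0 hc using hrat
  have hper : ∀ r : ℚ≥0, a (r + D) = a r ∧ b (r + D) = b r ∧ c (r + D) = c r := by
    intro r
    refine quadratic_coeff_unique (r := ((r + D : ℚ≥0) : ℚ)) hD0 fun k => ?_
    rw [← hc]
    have := hc r (k + 1)
    have e : r + ((k + 1 : ℕ) : ℚ≥0) * D = r + D + k * D := by push_cast; ring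
    have e' : (r : ℚ) + ((k + 1 : ℕ) : ℚ) * D = ((r + D : ℚ≥0) : ℚ) + k * D := by
      push_cast; ring
    rw [e, e'] at this
    exact this
  have hDpos : (0 : ℚ≥0) < D := by exact_mod_cast hD
  refine ⟨fun i => match i with | 0 => c | 1 => b | 2 => a | _ => 0, ⟨?_, ?_, ?_⟩, ?_⟩
  · intro i
    refine ⟨D, hDpos, ?_⟩
    match i with
    | 0 => exact fun r => (hper r).2.2
    | 1 => exact fun r => (hper r).2.1
    | 2 => exact fun r => (hper r).1
    | _ + 3 => exact fun r => rfl
  · intro i hi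
    rw [hdim] at hi
    match i with
    | _ + 3 => rfl
  · intro r
    rw [hdim]
    have := hc r 0
    simp only [Nat.cast_zero, zero_mul, add_zero] at this
    simp only [Finset.sum_range_succ, Finset.range_zero, Finset.sum_empty]
    rw [this]
    ring
  · intro r
    have : |((b r : ℚ) : ℝ)| ≤ b 0 := by
      rw [hb0 0 rfl]
      exact hb r
    exact_mod_cast this

theorem theorem1p7 {n : ℕ} (P : Set (Fin n → ℝ)) (hP : IsRationalPolytope P)
    (hdim : setDim P = 2) :
    IsRationalEhrhartExpansion P (rationalEhrhartCoeff P) ∧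
      ∃ q : ℚ≥0, IsRationalDenominator P q ∧
        ∀ r : ℚ≥0, r < q → |rationalEhrhartCoeff P 1 r| ≤ rationalEhrhartCoeff P 1 0 := by
  obtain ⟨c, hc, hle⟩ := exists_isRationalEhrhartExpansion hP hdim
  have hex : ∃ c, IsRationalEhrhartExpansion P c := ⟨c, hc⟩
  have hcoeff : IsRationalEhrhartExpansion P (rationalEhrhartCoeff P) := by
    rw [rationalEhrhartCoeff, dif_pos hex]
    exact hex.choose_spec
  obtain ⟨q, hq⟩ := exists_isRationalDenominator hP (by omega)
  refine ⟨hcoeff, q, hq, fun r _ => ?_⟩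
  -- The bound is known for the constructed expansion; uniqueness carries it to the chosen one.
  rw [hcoeff.unique hc]
  exact hle r
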